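/- Let $X$ be a metric space and $\varepsilon>0$. An $\varepsilon$-chain is a finite sequence $\alpha=\{x_0,\dots,x_n\}$ in $X$ with $d(x_i,x_{i+1})<\varepsilon$ for all $i$; its length is $L(\alpha)=\sum_i d(x_i,x_{i+1})$. A basic move adds or removes one point, keeping the endpoints and the property of being an $\varepsilon$-chain; two $\varepsilon$-chains are $\varepsilon$-homotopic if they are joined by finitely many basic moves. Let $[\alpha]_\varepsilon$ be the $\varepsilon$-homotopy class of $\alpha$ and $|[\alpha]_\varepsilon|$ the infimum of the lengths of the chains in it. An $\varepsilon$-loop is $\varepsilon$-null if it is $\varepsilon$-homotopic to a one-point chain. The homotopy critical spectrum of $X$ is the set of all $\varepsilon>0$ for which some $\varepsilon$-loop is not $\varepsilon$-null but is $\delta$-null for every $\delta>\varepsilon$. For a base point $*\in X$, let $X_\varepsilon$ be the set of all classes $[\alpha]_\varepsilon$ of $\varepsilon$-chains starting at $*$, with the metric $d([\alpha]_\varepsilon,[\beta]_\varepsilon)=|[\overline\alpha*\beta]_\varepsilon|$ ($\overline\alpha$ is the reversed chain, $*$ between chains is concatenation); let $\phi_\varepsilon:X_\varepsilon\to X$ send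 $[\alpha]_\varepsilon$ to the endpoint of $\alpha$; and let $\pi_\varepsilon(X)$ be the group of classes of $\varepsilon$-loops at $*$ under concatenation. For a path $c:[0,1]\to X$ let $|[c]|\in[0,\infty]$ be the infimum of the lengths of the paths in its fixed-endpoint homotopy class $[c]$, and let $\Lambda([c])=[c(t_0),\dots,c(t_n)]_\varepsilon$ for any subdivision $0=t_0<\dots<t_n=1$ with $c([t_i,t_{i+1}])\subset B(c(t_i),\varepsilon)$ for all $i$ (this is well defined). A geodesic space is a metric space in which any two points are joined by an arclength parametrized curve whose length is their distance. A path is locally minimizing if, parametrized proportionally to arclength, it is up to a positive scale factor a local isometry; a closed geodesic is a map from a circle of some length (with its arc metric) to $X$ whose restriction to every sufficiently small arc is an isometry onto its image. **Theorem.** Let $X$ be a compact semilocally simply connected geodesic space. Then the homotopy critical spectrum of $X$ has a positive lower bound. If $\varepsilon>0$ is any such lower bound, then: 1. For every base point, $\phi_\varepsilon:X_\varepsilon\to X$ is the universal covering map of $X$ (a surjective covering map with simply connected total space). 2. $|\Lambda([c])|=|[c]|$ for every path $c$ in $X$ (in particular $|[c]|<\infty$), and for every base point $\Lambda$ restricts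 to a group isomorphism $\pi_1(X)\to\pi_\varepsilon(X)$. 3. For every path $c$ in $X$, the fixed-endpoint homotopy class of $c$ contains a shortest path which is either constant or locally minimizing; moreover every shortest path in the class is constant or a monotone reparametrization of a locally minimizing path. 4. For every path loop $c$ in $X$, the free homotopy class of $c$ contains a shortest loop which is either constant or a closed geodesic; moreover every shortest loop in the class is constant or a monotone reparametrization of a closed geodesic. -/

import Mathlib

open scoped unitInterval ENNReal

namespace DiscreteHomotopy

noncomputable section

/-! ### Chains and their homotopies -/

/-- An `ε`-chain from `x` to `y`: a finite sequence of points `x = x₀, x₁, …, xₙ = y`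
with `dist xᵢ xᵢ₊₁ < ε`. The field `tail` is `x₁, …, xₙ`. -/
@[ext]
structure EpsChain {X : Type*} [MetricSpace X] (ε : ℝ) (x y : X) where
  tail : List X
  isChain : (x :: tail).IsChain (fun a b => dist a b < ε)
  getLast_eq : (x :: tail).getLast (List.cons_ne_nil x tail) = y

/-- `l'` arises from `l` by inserting a single point. -/
def InsertPoint {X : Type*} (l l' : List X) : Prop :=
  ∃ (l₁ l₂ : List X) (p : X), l = l₁ ++ l₂ ∧ l' = l₁ ++ p :: l₂

/-- The length of a finite sequence of points: the sum of the distances of successive points. -/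
def listLength {X : Type*} [MetricSpace X] : List X → ℝ
  | [] => 0
  | [_] => 0
  | a :: b :: l => dist a b + listLength (b :: l)

namespace EpsChain

variable {X : Type*} [MetricSpace X] {ε : ℝ} {x y z : X}

/-- All points `x₀, x₁, …, xₙ` of a chain. -/
def points (α : EpsChain ε x y) : List X := x :: α.tail

/-- The length of a chain. -/
def length (α : EpsChain ε x y) : ℝ := listLength α.points

/-- A basic move: adding or removing a single point, keeping the endpoints. -/
def BasicMove (α β : EpsChain ε x y) : Prop :=
  InsertPoint α.points β.points ∨ InsertPoint β.points α.points

/-- Two `ε`-chains with the same endpoints are `ε`-homotopic if they are joined by a finite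
sequence of `ε`-chains in which successive ones differ by a basic move. -/
def Homotopic (α β : EpsChain ε x y) : Prop := Relation.ReflTransGen BasicMove α β

/-- The chain `{x}`. -/
def single (ε : ℝ) (x : X) : EpsChain ε x x where
  tail := []
  isChain := by simp
  getLast_eq := by simp

/-- The chain `{x, y}`. -/
def pair (h : dist x y < ε) : EpsChain ε x y where
  tail := [y]
  isChain := by simpa using h
  getLast_eq := by simp

/-- An `ε`-loop is `ε`-null if it is `ε`-homotopic to the trivial loop. -/
def IsNull (α : EpsChain ε x x) : Prop := Homotopic α (single ε x)

/-- An `ε`-chain regarded as a `δ`-chain, for `ε ≤ δ`. -/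
def ofLE {δ : ℝ} (h : ε ≤ δ) (α : EpsChain ε x y) : EpsChain δ x y where
  tail := α.tail
  isChain := α.isChain.imp fun _ _ hab => lt_of_lt_of_le hab h
  getLast_eq := α.getLast_eq

/-- Concatenation `{x₀, …, xₙ = y₀, …, yₘ}`. -/
def concat (α : EpsChain ε x y) (β : EpsChain ε y z) : EpsChain ε x z where
  tail := α.tail ++ β.tail
  isChain := by
    rw [← List.cons_append, List.isChain_append]
    refine ⟨α.isChain, β.isChain.tail, ?_⟩
    intro a ha b hb
    have h1 := α.getLast_eq
    rw [List.getLast?_eq_some_getLast (List.cons_ne_nil x α.tail), h1] at ha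
    simp only [Option.mem_def, Option.some.injEq] at ha
    subst ha
    have h2 := β.isChain
    cases ht : β.tail with
    | nil => simp [ht] at hb
    | cons c l =>
      rw [ht] at h2 hb
      simp only [List.head?_cons, Option.mem_def, Option.some.injEq] at hb
      subst hb
      exact (List.isChain_cons_cons.1 h2).1
  getLast_eq := by
    have h1 := α.getLast_eq
    have h2 := β.getLast_eq
    cases ht : β.tail with
    | nil => simp_all
    | cons c l => simp_all

/-- The reversal `{xₙ, …, x₀}`. -/
def reverse (α : EpsChain ε x y) : EpsChain ε y x where
  tail := α.points.reverse.tail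
  isChain := by
    have h : y :: α.points.reverse.tail = α.points.reverse := by
      have h1 := α.getLast_eq
      have h2 : α.points.reverse ≠ [] := by simp [points]
      rw [← List.cons_head_tail h2]
      simp only [List.head_reverse, List.tail_cons]
      simp only [points, h1]
    rw [h, List.isChain_reverse]
    exact α.isChain.imp fun a b hab => by simpa [flip, dist_comm] using hab
  getLast_eq := by
    have h : y :: α.points.reverse.tail = α.points.reverse := by
      have h1 := α.getLast_eq
      have h2 : α.points.reverse ≠ [] := by simp [points]
      rw [← List.cons_head_tail h2]
      simp only [List.head_reverse, List.tail_cons]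
      simp only [points, h1]
    simp only [h, List.getLast_reverse]
    simp [points]

theorem points_reverse (α : EpsChain ε x y) : α.reverse.points = α.points.reverse := by
  have h1 := α.getLast_eq
  have h2 : α.points.reverse ≠ [] := by simp [points]
  rw [← List.cons_head_tail h2]
  simp only [List.head_reverse]
  simp only [points, reverse, h1]

theorem points_concat (α : EpsChain ε x y) (β : EpsChain ε y z) :
    (α.concat β).points = α.points ++ β.tail := rfl

theorem ext_points {α β : EpsChain ε x y} (h : α.points = β.points) : α = β := by
  ext1
  simpa [points] using h

theorem concat_assoc {w : X} (α : EpsChain ε x y) (β : EpsChain ε y z) (γ : EpsChain ε z w) :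
    (α.concat β).concat γ = α.concat (β.concat γ) := by
  ext1
  simp [concat]

theorem single_concat (α : EpsChain ε x y) : (single ε x).concat α = α := by
  ext1
  simp [concat, single]

theorem concat_single (α : EpsChain ε x y) : α.concat (single ε y) = α := by
  ext1
  simp [concat, single]

theorem reverse_reverse (α : EpsChain ε x y) : α.reverse.reverse = α := by
  apply ext_points
  simp [points_reverse]

theorem reverse_concat (α : EpsChain ε x y) (β : EpsChain ε y z) :
    (α.concat β).reverse = β.reverse.concat α.reverse := by
  apply ext_points
  rw [points_reverse, points_concat, points_concat, points_reverse, List.reverse_append]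
  have h : α.reverse.tail = α.points.reverse.tail := rfl
  rw [h]
  have h3 : α.points.reverse = y :: α.points.reverse.tail := by
    rw [← points_reverse]
    rfl
  conv_lhs => rw [h3]
  simp [points]

theorem basicMove_symm {α β : EpsChain ε x y} (h : BasicMove α β) : BasicMove β α := Or.symm h

namespace Homotopic

theorem refl (α : EpsChain ε x y) : Homotopic α α := Relation.ReflTransGen.refl

theorem symm {α β : EpsChain ε x y} (h : Homotopic α β) : Homotopic β α := by
  induction h with
  | refl => exact Relation.ReflTransGen.refl
  | tail _ h ih => exact Relation.ReflTransGen.head (basicMove_symm h) ih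

theorem trans {α β γ : EpsChain ε x y} (h : Homotopic α β) (h' : Homotopic β γ) :
    Homotopic α γ := Relation.ReflTransGen.trans h h'

theorem of_insert {α β : EpsChain ε x y} (h : InsertPoint α.points β.points) :
    Homotopic α β := .single (Or.inl h)

end Homotopic

theorem insert_concat_right {α α' : EpsChain ε x y} (β : EpsChain ε y z)
    (h : InsertPoint α.points α'.points) :
    InsertPoint (α.concat β).points (α'.concat β).points := by
  obtain ⟨l₁, l₂, p, h1, h2⟩ := h
  exact ⟨l₁, l₂ ++ β.tail, p, by simp [points_concat, h1], by simp [points_concat, h2]⟩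

theorem insert_reverse {α α' : EpsChain ε x y} (h : InsertPoint α.points α'.points) :
    InsertPoint α.reverse.points α'.reverse.points := by
  obtain ⟨l₁, l₂, p, h1, h2⟩ := h
  exact ⟨l₂.reverse, l₁.reverse, p, by simp [points_reverse, h1], by simp [points_reverse, h2]⟩

theorem Homotopic.concat_right {α α' : EpsChain ε x y} (h : Homotopic α α')
    (β : EpsChain ε y z) : Homotopic (α.concat β) (α'.concat β) := by
  induction h with
  | refl => exact .refl _
  | tail _ h ih =>
    exact .tail ih (Or.imp (insert_concat_right β) (insert_concat_right β) h)

theorem Homotopic.reverse {α α' : EpsChain ε x y} (h : Homotopic α α') :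
    Homotopic α.reverse α'.reverse := by
  induction h with
  | refl => exact .refl _
  | tail _ h ih => exact .tail ih (Or.imp insert_reverse insert_reverse h)

theorem Homotopic.concat_left (α : EpsChain ε x y) {β β' : EpsChain ε y z}
    (h : Homotopic β β') : Homotopic (α.concat β) (α.concat β') := by
  have := (h.reverse.concat_right α.reverse).reverse
  simpa [← reverse_concat, reverse_reverse] using this

/-- The middle point of `{x, y, z}` may be removed if the result is a chain. -/
theorem pair_concat_pair (hxy : dist x y < ε) (hyz : dist y z < ε) (hxz : dist x z < ε) :
    Homotopic ((pair hxy).concat (pair hyz)) (pair hxz) :=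
  (Homotopic.of_insert ⟨[x], [z], y, rfl, rfl⟩).symm

theorem pair_self (h : dist x x < ε) : Homotopic (pair h) (single ε x) :=
  (Homotopic.of_insert ⟨[x], [], x, rfl, rfl⟩).symm

/-- A chain with at least two points splits off its first step. -/
theorem eq_pair_concat {b : X} {l : List X} (α : EpsChain ε x y) (h : α.tail = b :: l) :
    ∃ (hb : dist x b < ε) (β : EpsChain ε b y), β.tail = l ∧ α = (pair hb).concat β := by
  have h1 := α.isChain
  have h2 := α.getLast_eq
  simp only [h] at h1 h2
  refine ⟨(List.isChain_cons_cons.1 h1).1, ⟨l, (List.isChain_cons_cons.1 h1).2, ?_⟩, rfl, ?_⟩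
  · simpa using h2
  · ext1
    simp [concat, pair, h]

/-- A chain with only one point is trivial. -/
theorem eq_single_of_tail_nil (α : EpsChain ε x x) (h : α.tail = []) : α = single ε x := by
  ext1
  simpa [single] using h

theorem concat_reverse (α : EpsChain ε x y) :
    Homotopic (α.concat α.reverse) (single ε x) := by
  suffices H : ∀ (l : List X) (x : X) (α : EpsChain ε x y), α.tail = l →
      Homotopic (α.concat α.reverse) (single ε x) from H _ x α rfl
  intro l
  induction l with
  | nil =>
    intro x α h
    have h2 := α.getLast_eq
    simp only [h, List.getLast_singleton] at h2
    subst h2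
    rw [eq_single_of_tail_nil α h]
    exact Homotopic.refl _
  | cons b l ih =>
    intro x α h
    obtain ⟨hb, β, hβ, rfl⟩ := eq_pair_concat α h
    have hxx : dist x x < ε := by
      rw [dist_self]
      exact lt_of_le_of_lt dist_nonneg hb
    have hr : (pair hb).reverse = pair (by rwa [dist_comm] : dist b x < ε) := by
      apply ext_points
      rw [points_reverse]
      rfl
    rw [reverse_concat, concat_assoc, ← concat_assoc β]
    refine (((ih b β hβ).concat_right _).concat_left _).trans ?_
    rw [single_concat, hr]
    exact (pair_concat_pair _ _ hxx).trans (pair_self hxx)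

theorem length_nonneg (α : EpsChain ε x y) : 0 ≤ α.length := by
  suffices H : ∀ l : List X, 0 ≤ listLength l from H _
  intro l
  induction l with
  | nil => simp [listLength]
  | cons a l ih =>
    cases l with
    | nil => simp [listLength]
    | cons b l => exact add_nonneg dist_nonneg ih

theorem length_pair_concat (h : dist x y < ε) (α : EpsChain ε y z) :
    ((pair h).concat α).length = dist x y + α.length := rfl

theorem length_concat (α : EpsChain ε x y) (β : EpsChain ε y z) :
    (α.concat β).length = α.length + β.length := by
  suffices H : ∀ (l : List X) (x : X) (α : EpsChain ε x y), α.tail = l →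
      (α.concat β).length = α.length + β.length from H _ x α rfl
  intro l
  induction l with
  | nil =>
    intro x α h
    have h2 := α.getLast_eq
    simp only [h, List.getLast_singleton] at h2
    subst h2
    rw [eq_single_of_tail_nil α h, single_concat]
    simp [length, points, single, listLength]
  | cons b l ih =>
    intro x α h
    obtain ⟨hb, γ, hγ, rfl⟩ := eq_pair_concat α h
    rw [concat_assoc, length_pair_concat, length_pair_concat, ih b γ hγ, add_assoc]

theorem length_reverse (α : EpsChain ε x y) : α.reverse.length = α.length := by
  suffices H : ∀ (l : List X) (x : X) (α : EpsChain ε x y), α.tail = l →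
      α.reverse.length = α.length from H _ x α rfl
  intro l
  induction l with
  | nil =>
    intro x α h
    have h2 := α.getLast_eq
    simp only [h, List.getLast_singleton] at h2
    subst h2
    rw [eq_single_of_tail_nil α h]
    rfl
  | cons b l ih =>
    intro x α h
    obtain ⟨hb, γ, hγ, rfl⟩ := eq_pair_concat α h
    have hr : (pair hb).reverse = pair (by rwa [dist_comm] : dist b x < ε) := by
      apply ext_points
      rw [points_reverse]
      rfl
    rw [reverse_concat, length_concat, ih b γ hγ, hr, length_pair_concat]
    simp [length, points, pair, listLength, dist_comm, add_comm]

theorem dist_le_length (α : EpsChain ε x y) : dist x y ≤ α.length := by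
  suffices H : ∀ (l : List X) (x : X) (α : EpsChain ε x y), α.tail = l →
      dist x y ≤ α.length from H _ x α rfl
  intro l
  induction l with
  | nil =>
    intro x α h
    have h2 := α.getLast_eq
    simp only [h, List.getLast_singleton] at h2
    subst h2
    simpa using α.length_nonneg
  | cons b l ih =>
    intro x α h
    obtain ⟨hb, γ, hγ, rfl⟩ := eq_pair_concat α h
    rw [length_pair_concat]
    exact (dist_triangle x b y).trans (add_le_add le_rfl (ih b γ hγ))

/-- A chain shorter than `ε` is homotopic to the chain of its two endpoints. -/
theorem homotopic_pair (α : EpsChain ε x y) (h : α.length < ε) :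
    Homotopic α (pair (lt_of_le_of_lt α.dist_le_length h)) := by
  suffices H : ∀ (l : List X) (x : X) (α : EpsChain ε x y) (h : α.length < ε), α.tail = l →
      Homotopic α (pair (lt_of_le_of_lt α.dist_le_length h)) from H _ x α h rfl
  intro l
  induction l with
  | nil =>
    intro x α h hl
    have h2 := α.getLast_eq
    simp only [hl, List.getLast_singleton] at h2
    subst h2
    have h3 := eq_single_of_tail_nil α hl
    subst h3
    exact (pair_self _).symm
  | cons b l ih =>
    intro x α h hl
    obtain ⟨hb, γ, hγ, rfl⟩ := eq_pair_concat α hl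
    have h' : γ.length < ε := by
      rw [length_pair_concat] at h
      have := dist_nonneg (x := x) (y := b)
      linarith
    exact ((ih b γ h' hγ).concat_left _).trans (pair_concat_pair _ _ _)

end EpsChain

/-! ### Homotopy classes of chains, the group `π_ε` and the space `X_ε` -/

/-- `ε`-homotopy as an equivalence relation on the `ε`-chains from `x` to `y`. -/
def chainSetoid {X : Type*} [MetricSpace X] (ε : ℝ) (x y : X) : Setoid (EpsChain ε x y) where
  r := EpsChain.Homotopic
  iseqv := ⟨EpsChain.Homotopic.refl, EpsChain.Homotopic.symm, EpsChain.Homotopic.trans⟩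

/-- The set of `ε`-homotopy classes `[α]_ε` of `ε`-chains from `x` to `y`. -/
def ChainClass {X : Type*} [MetricSpace X] (ε : ℝ) (x y : X) : Type _ :=
  Quotient (chainSetoid ε x y)

namespace ChainClass

variable {X : Type*} [MetricSpace X] {ε : ℝ} {w x y z : X}

/-- The class `[α]_ε`. -/
def mk (α : EpsChain ε x y) : ChainClass ε x y := Quotient.mk (chainSetoid ε x y) α

theorem mk_eq_mk {α β : EpsChain ε x y} : mk α = mk β ↔ EpsChain.Homotopic α β :=
  Quotient.eq (r := chainSetoid ε x y)

theorem mk_surjective (a : ChainClass ε x y) : ∃ α : EpsChain ε x y, mk α = a :=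
  Quotient.exists_rep a

/-- The class of the trivial chain. -/
def one (ε : ℝ) (x : X) : ChainClass ε x x := mk (EpsChain.single ε x)

/-- Concatenation of classes. -/
def concat : ChainClass ε x y → ChainClass ε y z → ChainClass ε x z :=
  Quotient.map₂ EpsChain.concat fun _ _ h _ _ h' => (h.concat_right _).trans (h'.concat_left _)

/-- Reversal of classes. -/
def reverse : ChainClass ε x y → ChainClass ε y x :=
  Quotient.map EpsChain.reverse fun _ _ h => h.reverse

/-- `|[α]_ε|`, the infimum of the lengths of the chains in the class. -/
def norm (a : ChainClass ε x y) : ℝ := sInf {r | ∃ γ : EpsChain ε x y, mk γ = a ∧ γ.length = r}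

theorem concat_mk (α : EpsChain ε x y) (β : EpsChain ε y z) :
    concat (mk α) (mk β) = mk (α.concat β) := rfl

theorem reverse_mk (α : EpsChain ε x y) : reverse (mk α) = mk α.reverse := rfl

theorem concat_assoc (a : ChainClass ε w x) (b : ChainClass ε x y) (c : ChainClass ε y z) :
    concat (concat a b) c = concat a (concat b c) := by
  obtain ⟨α, rfl⟩ := mk_surjective a
  obtain ⟨β, rfl⟩ := mk_surjective b
  obtain ⟨γ, rfl⟩ := mk_surjective c
  simp only [concat_mk, EpsChain.concat_assoc]

theorem one_concat (a : ChainClass ε x y) : concat (one ε x) a = a := by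
  obtain ⟨α, rfl⟩ := mk_surjective a
  simp only [one, concat_mk, EpsChain.single_concat]

theorem concat_one (a : ChainClass ε x y) : concat a (one ε y) = a := by
  obtain ⟨α, rfl⟩ := mk_surjective a
  simp only [one, concat_mk, EpsChain.concat_single]

theorem concat_reverse (a : ChainClass ε x y) : concat a (reverse a) = one ε x := by
  obtain ⟨α, rfl⟩ := mk_surjective a
  exact mk_eq_mk.2 α.concat_reverse

theorem reverse_reverse (a : ChainClass ε x y) : reverse (reverse a) = a := by
  obtain ⟨α, rfl⟩ := mk_surjective a
  simp only [reverse_mk, EpsChain.reverse_reverse]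

theorem reverse_concat (a : ChainClass ε x y) (b : ChainClass ε y z) :
    reverse (concat a b) = concat (reverse b) (reverse a) := by
  obtain ⟨α, rfl⟩ := mk_surjective a
  obtain ⟨β, rfl⟩ := mk_surjective b
  simp only [reverse_mk, concat_mk, EpsChain.reverse_concat]

theorem reverse_concat_self (a : ChainClass ε x y) : concat (reverse a) a = one ε y := by
  conv_lhs => rw [← reverse_reverse a, reverse_reverse (reverse a)]
  exact concat_reverse (reverse a)

theorem norm_le_length (α : EpsChain ε x y) : norm (mk α) ≤ α.length :=
  csInf_le ⟨0, by rintro _ ⟨γ, -, rfl⟩; exact γ.length_nonneg⟩ ⟨α, rfl, rfl⟩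

theorem le_norm {a : ChainClass ε x y} {r : ℝ}
    (h : ∀ γ : EpsChain ε x y, mk γ = a → r ≤ γ.length) : r ≤ norm a := by
  obtain ⟨α, hα⟩ := mk_surjective a
  exact le_csInf ⟨_, α, hα, rfl⟩ (by rintro _ ⟨γ, hγ, rfl⟩; exact h γ hγ)

theorem dist_le_norm (a : ChainClass ε x y) : dist x y ≤ norm a :=
  le_norm fun γ _ => γ.dist_le_length

theorem norm_nonneg (a : ChainClass ε x y) : 0 ≤ norm a := dist_nonneg.trans (dist_le_norm a)

theorem norm_one : norm (one ε x) = 0 := by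
  refine le_antisymm ((norm_le_length _).trans ?_) (norm_nonneg _)
  simp [EpsChain.length, EpsChain.points, EpsChain.single, listLength]

theorem norm_reverse_le (a : ChainClass ε x y) : norm (reverse a) ≤ norm a := by
  refine le_norm ?_
  rintro γ rfl
  rw [reverse_mk, ← γ.length_reverse]
  exact norm_le_length _

theorem norm_reverse (a : ChainClass ε x y) : norm (reverse a) = norm a :=
  le_antisymm (norm_reverse_le a) (by simpa [reverse_reverse] using norm_reverse_le (reverse a))

theorem norm_concat_le (a : ChainClass ε x y) (b : ChainClass ε y z) :
    norm (concat a b) ≤ norm a + norm b := by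
  rw [← sub_le_iff_le_add]
  refine le_norm ?_
  rintro α rfl
  rw [sub_le_comm]
  refine le_norm ?_
  rintro β rfl
  rw [sub_le_iff_le_add, add_comm, ← EpsChain.length_concat, concat_mk]
  exact norm_le_length _

theorem eq_one_of_norm_eq_zero (a : ChainClass ε x x) (h : norm a = 0) : a = one ε x := by
  by_cases hε : 0 < ε
  · obtain ⟨γ, hγ, hl⟩ : ∃ γ : EpsChain ε x x, mk γ = a ∧ γ.length < ε := by
      by_contra! hcon
      have := le_norm hcon
      linarith
    subst hγ
    exact mk_eq_mk.2 ((γ.homotopic_pair hl).trans (EpsChain.pair_self _))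
  · obtain ⟨γ, rfl⟩ := mk_surjective a
    cases ht : γ.tail with
    | nil => rw [EpsChain.eq_single_of_tail_nil γ ht]; rfl
    | cons b l =>
      obtain ⟨hb, -⟩ := γ.eq_pair_concat ht
      exact absurd (lt_of_le_of_lt dist_nonneg hb) hε

end ChainClass

/-- The group `π_ε(X, p)`: classes of `ε`-loops at `p`, with the product `[α][β] = [α * β]`
induced by concatenation. -/
abbrev EpsGroup {X : Type*} [MetricSpace X] (ε : ℝ) (p : X) : Type _ := ChainClass ε p p

instance {X : Type*} [MetricSpace X] (ε : ℝ) (p : X) : Group (ChainClass ε p p) where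
  mul := ChainClass.concat
  mul_assoc := ChainClass.concat_assoc
  one := ChainClass.one ε p
  one_mul := ChainClass.one_concat
  mul_one := ChainClass.concat_one
  inv := ChainClass.reverse
  inv_mul_cancel := ChainClass.reverse_concat_self

/-- The space `X_ε` with base point `p`: all classes `[α]_ε` of `ε`-chains starting at `p`,
with arbitrary endpoints. -/
structure EpsCover {X : Type*} [MetricSpace X] (ε : ℝ) (p : X) where
  endpoint : X
  cls : ChainClass ε p endpoint

/-- The endpoint map `φ_ε : X_ε → X`. -/
def endpointMap {X : Type*} [MetricSpace X] (ε : ℝ) (p : X) (a : EpsCover ε p) : X := a.endpoint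

/-- The metric of `X_ε`: the distance of `[α]` and `[β]` is `|[ᾱ * β]|`, where `ᾱ` is the
reversal of `α`. -/
instance {X : Type*} [MetricSpace X] (ε : ℝ) (p : X) : MetricSpace (EpsCover ε p) where
  dist a b := ((a.cls.reverse).concat b.cls).norm
  dist_self a := by
    show ((a.cls.reverse).concat a.cls).norm = 0
    rw [ChainClass.reverse_concat_self, ChainClass.norm_one]
  dist_comm a b := by
    show ((a.cls.reverse).concat b.cls).norm = ((b.cls.reverse).concat a.cls).norm
    rw [← ChainClass.norm_reverse, ChainClass.reverse_concat, ChainClass.reverse_reverse]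
  dist_triangle a b c := by
    show ((a.cls.reverse).concat c.cls).norm ≤
      ((a.cls.reverse).concat b.cls).norm + ((b.cls.reverse).concat c.cls).norm
    refine le_of_eq_of_le ?_ (ChainClass.norm_concat_le _ _)
    rw [ChainClass.concat_assoc, ← ChainClass.concat_assoc b.cls, ChainClass.concat_reverse,
      ChainClass.one_concat]
  eq_of_dist_eq_zero := by
    rintro ⟨y, a⟩ ⟨z, b⟩ h
    change ((a.reverse).concat b).norm = 0 at h
    have hyz : y = z := dist_le_zero.1 (h ▸ ChainClass.dist_le_norm (a.reverse.concat b))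
    subst hyz
    have h1 := ChainClass.eq_one_of_norm_eq_zero _ h
    have h2 : b = a := by
      rw [← ChainClass.one_concat b, ← ChainClass.concat_reverse a, ChainClass.concat_assoc, h1,
        ChainClass.concat_one]
    rw [h2]

/-! ### Homotopy critical values -/

/-- The homotopy critical spectrum: all `ε > 0` for which there is an `ε`-critical `ε`-loop,
that is, one that is not `ε`-null but is `δ`-null for every `δ > ε`. -/
def homotopyCriticalSpectrum (X : Type*) [MetricSpace X] : Set ℝ :=
  {ε | 0 < ε ∧ ∃ (x : X) (α : EpsChain ε x x),
    ¬ α.IsNull ∧ ∀ (δ : ℝ) (h : ε < δ), (α.ofLE h.le).IsNull}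

/-! ### Paths -/

/-- A geodesic space: any two points are joined by an arclength parametrized length minimizing
curve. -/
def IsGeodesicSpace (X : Type*) [MetricSpace X] : Prop :=
  ∀ x y : X, ∃ γ : ℝ → X, γ 0 = x ∧ γ (dist x y) = y ∧
    ∀ s ∈ Set.Icc 0 (dist x y), ∀ t ∈ Set.Icc 0 (dist x y), dist (γ s) (γ t) = |s - t|

/-- Semilocal simple connectedness: every point `x` has a neighbourhood `U` such that each loop
at `x` in `U` is null-homotopic in `X`. -/
def IsSemilocallySimplyConnected (X : Type*) [TopologicalSpace X] : Prop :=
  ∀ x : X, ∃ U ∈ nhds x, ∀ c : Path x x, Set.range c ⊆ U → c.Homotopic (Path.refl x)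

/-- A universal covering map: a surjective covering map with simply connected total space. -/
def IsUniversalCoveringMap {E B : Type*} [TopologicalSpace E] [TopologicalSpace B]
    (f : E → B) : Prop :=
  IsCoveringMap f ∧ Function.Surjective f ∧ SimplyConnectedSpace E

/-- The length of a path (possibly infinite). -/
def pathLength {X : Type*} [MetricSpace X] {x y : X} (c : Path x y) : ℝ≥0∞ :=
  eVariationOn c Set.univ

/-- `|[c]|`, the infimum of the lengths of the paths in a fixed-endpoint homotopy class. -/
def pathClassNorm {X : Type*} [MetricSpace X] {x y : X}
    (q : Path.Homotopic.Quotient x y) : ℝ≥0∞ :=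
  ⨅ (c : Path x y) (_ : Path.Homotopic.Quotient.mk c = q), pathLength c

/-- Free homotopy of loops: a homotopy through loops, with moving base point. -/
def FreelyHomotopic {X : Type*} [TopologicalSpace X] {x y : X} (c : Path x x) (c' : Path y y) :
    Prop :=
  ∃ H : C(I × I, X), (∀ t, H (0, t) = c t) ∧ (∀ t, H (1, t) = c' t) ∧ ∀ s, H (s, 0) = H (s, 1)

/-- `c'` is a shortest path in the fixed-endpoint homotopy class of `c`. -/
def IsShortestInClass {X : Type*} [MetricSpace X] {x y : X} (c c' : Path x y) : Prop :=
  c.Homotopic c' ∧ ∀ c'' : Path x y, c.Homotopic c'' → pathLength c' ≤ pathLength c''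

/-- `c'` is a shortest loop in the free homotopy class of `c`. -/
def IsShortestInFreeClass {X : Type*} [MetricSpace X] {x y : X} (c : Path x x) (c' : Path y y) :
    Prop :=
  FreelyHomotopic c c' ∧
    ∀ (z : X) (c'' : Path z z), FreelyHomotopic c c'' → pathLength c' ≤ pathLength c''

/-- `c` is constant. -/
def IsConstantPath {X : Type*} [TopologicalSpace X] {x y : X} (c : Path x y) : Prop :=
  ∀ t, c t = x

/-- `c` is locally minimizing: for some `ℓ > 0` the curve `s ↦ c (s / ℓ)` on `[0, ℓ]` is locally
an isometric embedding. -/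
def IsLocallyMinimizing {X : Type*} [MetricSpace X] {x y : X} (c : Path x y) : Prop :=
  ∃ ℓ : ℝ, 0 < ℓ ∧ ∀ t : I, ∃ U ∈ nhds t, ∀ s ∈ U, ∀ s' ∈ U,
    dist (c s) (c s') = ℓ * |(s : ℝ) - s'|

/-- `c` is a closed geodesic: it runs once, with constant speed, around a map from a circle of
some length `ℓ > 0`, with its arc metric, that is isometric on all sufficiently small arcs. -/
def IsClosedGeodesic {X : Type*} [MetricSpace X] {x : X} (c : Path x x) : Prop :=
  ∃ ℓ : ℝ, 0 < ℓ ∧ ∃ γ : AddCircle ℓ → X,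
    (∃ δ : ℝ, 0 < δ ∧ ∀ s t : AddCircle ℓ, dist s t < δ → dist (γ s) (γ t) = dist s t) ∧
    ∀ t : I, c t = γ ((ℓ * (t : ℝ) : ℝ) : AddCircle ℓ)

/-- `c` is a (weakly monotone, continuous, surjective) reparametrization of `g`. -/
def IsReparametrization {X : Type*} [TopologicalSpace X] {x y : X} (c g : Path x y) : Prop :=
  ∃ s : I → I, Continuous s ∧ Monotone s ∧ s 0 = 0 ∧ s 1 = 1 ∧ ∀ t, c t = g (s t)

/-! ### The map `Λ` from homotopy classes of paths to homotopy classes of chains -/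

/-- `α = {c(t₀), …, c(tₙ)}` for a subdivision `0 = t₀ < ⋯ < tₙ = 1` such that
`c([tᵢ, tᵢ₊₁])` is contained in the open ball `B(c(tᵢ), ε)` for every `i`. -/
def IsSubdivisionChain {X : Type*} [MetricSpace X] {ε : ℝ} {x y : X} (c : Path x y)
    (α : EpsChain ε x y) : Prop :=
  ∃ (n : ℕ) (t : ℕ → I), t 0 = 0 ∧ t n = 1 ∧ (∀ i < n, t i < t (i + 1)) ∧
    (∀ i < n, ∀ s ∈ Set.Icc (t i) (t (i + 1)), c s ∈ Metric.ball (c (t i)) ε) ∧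
    α.points = (List.range (n + 1)).map fun i => c (t i)

namespace EpsCover

variable {X : Type*} [MetricSpace X] {ε : ℝ} {x : X}

open Classical in
/-- Append the point `z` to a class of chains (if it is closer than `ε` to the endpoint). -/
def snoc (a : EpsCover ε x) (z : X) : EpsCover ε x :=
  if h : dist a.endpoint z < ε then ⟨z, a.cls.concat (ChainClass.mk (EpsChain.pair h))⟩ else a

theorem snoc_eq {a : EpsCover ε x} {z : X} (h : dist a.endpoint z < ε) :
    a.snoc z = ⟨z, a.cls.concat (ChainClass.mk (EpsChain.pair h))⟩ := dif_pos h

theorem snoc_fst {a : EpsCover ε x} {z : X} (h : dist a.endpoint z < ε) : (a.snoc z).endpoint = z := by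
  simp [snoc, h]

theorem snoc_snoc {a : EpsCover ε x} {z w : X} (h : dist a.endpoint z < ε) (h' : dist z w < ε)
    (h'' : dist a.endpoint w < ε) : (a.snoc z).snoc w = a.snoc w := by
  rw [snoc_eq h, snoc_eq h'', snoc_eq (a := ⟨z, _⟩) h', ChainClass.concat_assoc, ChainClass.concat_mk,
    ChainClass.mk_eq_mk.2 (EpsChain.pair_concat_pair h h' h'')]

theorem snoc_self (hε : 0 < ε) {a : EpsCover ε x} {z : X} (h : a.endpoint = z) : a.snoc z = a := by
  subst h
  have h0 : dist a.endpoint a.endpoint < ε := by simpa using hε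
  simp only [snoc, h0, dif_pos]
  have h1 : ChainClass.mk (EpsChain.pair h0) = ChainClass.one ε a.endpoint :=
    ChainClass.mk_eq_mk.2 (EpsChain.pair_self h0)
  rw [h1, ChainClass.concat_one]

/-- The class of the chain `x, f 1, …, f n`. -/
def ofSeq (ε : ℝ) (x : X) (f : ℕ → X) : ℕ → EpsCover ε x
  | 0 => ⟨x, ChainClass.one ε x⟩
  | n + 1 => (ofSeq ε x f n).snoc (f (n + 1))

theorem ofSeq_eq (f : ℕ → X) (h0 : f 0 = x) (n : ℕ) (h : ∀ i < n, dist (f i) (f (i + 1)) < ε) :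
    ∃ α : EpsChain ε x (f n), α.points = (List.range (n + 1)).map f ∧
      ofSeq ε x f n = ⟨f n, ChainClass.mk α⟩ := by
  induction n with
  | zero =>
    subst h0
    exact ⟨EpsChain.single ε _, by simp [EpsChain.points, EpsChain.single], rfl⟩
  | succ n ih =>
    obtain ⟨α, h1, h2⟩ := ih fun i hi => h i (by omega)
    have hn := h n (by omega)
    refine ⟨α.concat (EpsChain.pair hn), ?_, ?_⟩
    · rw [EpsChain.points_concat, h1, List.range_succ (n := n + 1), List.map_append]
      rfl
    · rw [ofSeq, h2]
      simp only [snoc, hn, dif_pos]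
      rfl

theorem ofSeq_fst (f : ℕ → X) (h0 : f 0 = x) (n : ℕ) (h : ∀ i < n, dist (f i) (f (i + 1)) < ε) :
    (ofSeq ε x f n).endpoint = f n := by
  obtain ⟨α, -, h2⟩ := ofSeq_eq f h0 n h
  rw [h2]

end EpsCover

/-- A fine modulus of continuity, in terms of `1 / M`. -/
theorem exists_fine_modulus {X Y : Type*} [MetricSpace X] [MetricSpace Y] [CompactSpace Y] {ε : ℝ}
    (hε : 0 < ε) (c : Y → X) (hc : Continuous c) :
    ∃ M : ℕ, 0 < M ∧ ∀ s t : Y, dist s t ≤ 1 / (M : ℝ) → dist (c s) (c t) < ε := by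
  obtain ⟨δ, hδ, h⟩ := Metric.uniformContinuous_iff.1
    (CompactSpace.uniformContinuous_of_continuous hc) ε hε
  obtain ⟨M, hM⟩ := exists_nat_one_div_lt hδ
  exact ⟨M + 1, by omega, fun s t hst => h (lt_of_le_of_lt hst (by exact_mod_cast hM))⟩

/-- The point `k / M` of the unit interval (capped at `1`). -/
def unitFrac (M k : ℕ) : I := Set.projIcc (0 : ℝ) 1 zero_le_one ((k : ℝ) / M)

theorem coe_unitFrac {M k : ℕ} (hM : 0 < M) (h : k ≤ M) : (unitFrac M k : ℝ) = k / M := by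
  have hM' : (0 : ℝ) < M := by exact_mod_cast hM
  have h' : (k : ℝ) ≤ M := by exact_mod_cast h
  unfold unitFrac
  rw [Set.projIcc_of_mem]
  exact ⟨by positivity, (div_le_one hM').2 h'⟩

theorem unitFrac_zero {M : ℕ} (hM : 0 < M) : unitFrac M 0 = 0 := by
  ext
  simp [coe_unitFrac hM (Nat.zero_le M)]

theorem unitFrac_self {M : ℕ} (hM : 0 < M) : unitFrac M M = 1 := by
  have hM' : (M : ℝ) ≠ 0 := by exact_mod_cast hM.ne'
  ext
  simp [coe_unitFrac hM le_rfl, hM']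

theorem coe_unitFrac_succ {M k : ℕ} (hM : 0 < M) (h : k < M) :
    (unitFrac M (k + 1) : ℝ) = unitFrac M k + 1 / M := by
  rw [coe_unitFrac hM h, coe_unitFrac hM h.le]
  push_cast
  ring

/-- Every path has a subdivision chain, by compactness. -/
theorem exists_isSubdivisionChain {X : Type*} [MetricSpace X] {ε : ℝ} (hε : 0 < ε) {x y : X}
    (c : Path x y) : ∃ α : EpsChain ε x y, IsSubdivisionChain c α := by
  obtain ⟨M, hM, h⟩ := exists_fine_modulus hε c c.continuous
  have hM' : (0 : ℝ) < M := by exact_mod_cast hM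
  have hball : ∀ i < M, ∀ s ∈ Set.Icc (unitFrac M i) (unitFrac M (i + 1)),
      c s ∈ Metric.ball (c (unitFrac M i)) ε := by
    intro i hi s hs
    apply h
    have h1 := coe_unitFrac_succ hM hi
    have h2 : (unitFrac M i : ℝ) ≤ s := hs.1
    have h3 : (s : ℝ) ≤ unitFrac M (i + 1) := hs.2
    rw [Subtype.dist_eq, Real.dist_eq, abs_le]
    constructor <;> linarith [show (0 : ℝ) < 1 / M by positivity]
  have hlt : ∀ i < M, unitFrac M i < unitFrac M (i + 1) := by
    intro i hi
    rw [← Subtype.coe_lt_coe, coe_unitFrac_succ hM hi]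
    linarith [show (0 : ℝ) < 1 / M by positivity]
  obtain ⟨α, hα, -⟩ := EpsCover.ofSeq_eq (ε := ε) (x := x) (fun i => c (unitFrac M i))
    (by simp [unitFrac_zero hM]) M fun i hi => by
      have := hball i hi _ (Set.right_mem_Icc.2 (hlt i hi).le)
      rwa [Metric.mem_ball, dist_comm] at this
  have hy : c (unitFrac M M) = y := by simp [unitFrac_self hM]
  refine ⟨⟨α.tail, α.isChain, α.getLast_eq.trans hy⟩, M, unitFrac M, unitFrac_zero hM,
    unitFrac_self hM, hlt, hball, hα⟩

/-- All sufficiently fine uniform subdivisions of a path give the class of any given subdivision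
chain. -/
theorem mk_eq_ofSeq {X : Type*} [MetricSpace X] {ε : ℝ} {x y : X} (c : Path x y)
    {α : EpsChain ε x y} (hα : IsSubdivisionChain c α) (hε : 0 < ε) {M : ℕ} (hM : 0 < M)
    (h : ∀ s t : I, dist s t ≤ 1 / (M : ℝ) → dist (c s) (c t) < ε) :
    (⟨y, ChainClass.mk α⟩ : EpsCover ε x) =
      EpsCover.ofSeq ε x (fun i => c (unitFrac M i)) M := by
  have hM' : (0 : ℝ) < M := by exact_mod_cast hM
  obtain ⟨n, t, ht0, htn, hlt, hball, hpts⟩ := hα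
  have hd : ∀ s t : I, |(s : ℝ) - t| ≤ 1 / M → dist (c s) (c t) < ε := h
  set K : ℕ → EpsCover ε x := EpsCover.ofSeq ε x (fun i => c (unitFrac M i)) with hK
  have hstep : ∀ i < M, dist (c (unitFrac M i)) (c (unitFrac M (i + 1))) < ε := by
    intro i hi
    apply hd
    rw [coe_unitFrac_succ hM hi, sub_add_cancel_left, abs_neg, abs_of_pos (by positivity)]
  have hKfst : ∀ i ≤ M, (K i).endpoint = c (unitFrac M i) := fun i hi =>
    EpsCover.ofSeq_fst _ (by simp [unitFrac_zero hM]) i fun j hj => hstep j (by omega)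
  have hKsucc : ∀ i, K (i + 1) = (K i).snoc (c (unitFrac M (i + 1))) := fun i => rfl
  -- the grid index just below `s`
  let fl : I → ℕ := fun s => ⌊(s : ℝ) * M⌋₊
  have hfl_le : ∀ s : I, (fl s : ℝ) ≤ s * M := fun s =>
    Nat.floor_le (mul_nonneg s.2.1 hM'.le)
  have hfl_lt : ∀ s : I, (s : ℝ) * M < fl s + 1 := fun s => Nat.lt_floor_add_one _
  have hflM : ∀ s : I, fl s ≤ M := by
    intro s
    have h1 := hfl_le s
    have h2 : (s : ℝ) * M ≤ 1 * M := mul_le_mul_of_nonneg_right s.2.2 hM'.le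
    exact_mod_cast (h1.trans h2).trans_eq (one_mul _)
  have hfl_le' : ∀ s : I, (unitFrac M (fl s) : ℝ) ≤ s := fun s => by
    rw [coe_unitFrac hM (hflM s), div_le_iff₀ hM']
    exact hfl_le s
  have hfl_lt' : ∀ s : I, (s : ℝ) < unitFrac M (fl s) + 1 / M := fun s => by
    rw [coe_unitFrac hM (hflM s), ← add_div, lt_div_iff₀ hM']
    exact hfl_lt s
  let U : I → EpsCover ε x := fun s => (K (fl s)).snoc (c s)
  have hUstep : ∀ s, dist (K (fl s)).endpoint (c s) < ε := by
    intro s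
    rw [hKfst _ (hflM s)]
    apply hd
    rw [abs_le]
    constructor <;> linarith [hfl_le' s, hfl_lt' s]
  have hUfst : ∀ s, (U s).endpoint = c s := fun s => EpsCover.snoc_fst (hUstep s)
  have key : ∀ u v : I, u ≤ v → (∀ s ∈ Set.Icc u v, c s ∈ Metric.ball (c u) ε) →
      U v = (U u).snoc (c v) := by
    intro u v huv hb
    have hb' : ∀ s ∈ Set.Icc u v, dist (U u).endpoint (c s) < ε := by
      intro s hs
      rw [hUfst, dist_comm]
      exact hb s hs
    have huv' : (u : ℝ) ≤ v := huv
    have hfle : fl u ≤ fl v := Nat.floor_mono (mul_le_mul_of_nonneg_right huv' hM'.le)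
    have hcuv : dist (c u) (c v) < ε := by
      rw [← hUfst u]
      exact hb' v (Set.right_mem_Icc.2 huv)
    rcases hfle.eq_or_lt with heq | hlt'
    · have h1 := hUstep v
      rw [← heq] at h1
      show (K (fl v)).snoc (c v) = ((K (fl u)).snoc (c u)).snoc (c v)
      rw [EpsCover.snoc_snoc (hUstep u) hcuv h1, heq]
    · have hgrid : ∀ j, fl u + 1 ≤ j → j ≤ fl v → unitFrac M j ∈ Set.Icc u v := by
        intro j hj1 hj2
        have hjM : j ≤ M := hj2.trans (hflM v)
        have hj1' : (fl u : ℝ) + 1 ≤ j := by exact_mod_cast hj1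
        have hj2' : (j : ℝ) ≤ fl v := by exact_mod_cast hj2
        constructor
        · rw [← Subtype.coe_le_coe, coe_unitFrac hM hjM, le_div_iff₀ hM']
          linarith [hfl_lt u]
        · rw [← Subtype.coe_le_coe, coe_unitFrac hM hjM, div_le_iff₀ hM']
          linarith [hfl_le v]
      have hind : ∀ j, fl u + 1 ≤ j → j ≤ fl v → K j = (U u).snoc (c (unitFrac M j)) := by
        intro j hj1
        induction j, hj1 using Nat.le_induction with
        | base =>
          intro hj2
          have huM : fl u < M := lt_of_lt_of_le hlt' (hflM v)
          have hmem := hgrid _ le_rfl hj2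
          have h1 : dist (c u) (c (unitFrac M (fl u + 1))) < ε := by
            rw [← hUfst u]
            exact hb' _ hmem
          have h2 : dist (K (fl u)).endpoint (c (unitFrac M (fl u + 1))) < ε := by
            rw [hKfst _ huM.le]
            exact hstep _ huM
          exact (EpsCover.snoc_snoc (hUstep u) h1 h2).symm
        | succ j hj1 ih =>
          intro hj2
          have hjM : j < M := lt_of_lt_of_le hj2 (hflM v)
          rw [hKsucc, ih (by omega)]
          exact EpsCover.snoc_snoc (hb' _ (hgrid j hj1 (by omega))) (hstep j hjM)
            (hb' _ (hgrid (j + 1) (by omega) hj2))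
      show (K (fl v)).snoc (c v) = _
      rw [hind (fl v) hlt' le_rfl]
      refine EpsCover.snoc_snoc (hb' _ (hgrid (fl v) hlt' le_rfl)) ?_
        (hb' v (Set.right_mem_Icc.2 huv))
      have h1 := hUstep v
      rwa [hKfst _ (hflM v)] at h1
  have hseq : ∀ i ≤ n, EpsCover.ofSeq ε x (fun i => c (t i)) i = U (t i) := by
    intro i
    induction i with
    | zero =>
      intro _
      have h0 : fl 0 = 0 := by simp [fl]
      show (⟨x, ChainClass.one ε x⟩ : EpsCover ε x) = (K (fl (t 0))).snoc (c (t 0))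
      rw [ht0, h0, EpsCover.snoc_self hε]
      · rfl
      · rw [c.source]
        rfl
    | succ i ih =>
      intro hi
      rw [EpsCover.ofSeq, ih (by omega)]
      exact (key _ _ (hlt i hi).le (hball i hi)).symm
  have hα' : (⟨y, ChainClass.mk α⟩ : EpsCover ε x) =
      EpsCover.ofSeq ε x (fun i => c (t i)) n := by
    obtain ⟨β, hβ1, hβ2⟩ := EpsCover.ofSeq_eq (ε := ε) (x := x) (fun i => c (t i))
      (by simp [ht0]) n fun i hi => by
        have := hball i hi _ (Set.right_mem_Icc.2 (hlt i hi).le)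
        rwa [Metric.mem_ball, dist_comm] at this
    have aux : ∀ (w : X) (β : EpsChain ε x w), w = y → β.points = α.points →
        (⟨y, ChainClass.mk α⟩ : EpsCover ε x) = ⟨w, ChainClass.mk β⟩ := by
      rintro w β rfl hβ
      rw [EpsChain.ext_points hβ]
    rw [hβ2]
    exact aux _ β (by simp [htn]) (hβ1.trans hpts.symm)
  rw [hα', hseq n le_rfl, htn]
  have h1 : fl 1 = M := by simp [fl]
  show (K (fl 1)).snoc (c 1) = K M
  rw [h1]
  apply EpsCover.snoc_self hε
  rw [hKfst M le_rfl, unitFrac_self hM]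

/-- Subdivision chains of homotopic paths are homotopic. -/
theorem homotopic_of_isSubdivisionChain {X : Type*} [MetricSpace X] {ε : ℝ} {x y : X}
    {c c' : Path x y} {α α' : EpsChain ε x y} (hε : 0 < ε) (h : c.Homotopic c')
    (hα : IsSubdivisionChain c α) (hα' : IsSubdivisionChain c' α') :
    α.Homotopic α' := by
  obtain ⟨H⟩ := h
  obtain ⟨M, hM, hd⟩ := exists_fine_modulus hε H H.continuous
  have hM' : (0 : ℝ) < M := by exact_mod_cast hM
  have hdist : ∀ i < M, dist (unitFrac M i) (unitFrac M (i + 1)) ≤ 1 / (M : ℝ) := by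
    intro i hi
    rw [Subtype.dist_eq, Real.dist_eq, coe_unitFrac_succ hM hi, sub_add_cancel_left, abs_neg,
      abs_of_pos (by positivity)]
  let V : ℕ → ℕ → EpsCover ε x := fun j =>
    EpsCover.ofSeq ε x fun k => H (unitFrac M j, unitFrac M k)
  have hrow : ∀ j, ∀ k < M,
      dist (H (unitFrac M j, unitFrac M k)) (H (unitFrac M j, unitFrac M (k + 1))) < ε := by
    intro j k hk
    apply hd
    rw [Prod.dist_eq]
    exact max_le (by simp) (hdist k hk)
  have hVfst : ∀ j, ∀ k ≤ M, (V j k).endpoint = H (unitFrac M j, unitFrac M k) := fun j k hk =>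
    EpsCover.ofSeq_fst _ (by simp [unitFrac_zero hM]) k fun i hi => hrow j i (by omega)
  have hV : ∀ j < M, ∀ k ≤ M,
      V (j + 1) k = (V j k).snoc (H (unitFrac M (j + 1), unitFrac M k)) := by
    intro j hj k
    induction k with
    | zero =>
      intro _
      rw [EpsCover.snoc_self hε]
      · rfl
      · rw [hVfst j 0 (by omega), unitFrac_zero hM]
        simp
    | succ k ih =>
      intro hk
      have hcol : ∀ k, dist (H (unitFrac M j, unitFrac M k))
          (H (unitFrac M (j + 1), unitFrac M k)) < ε := by
        intro k
        apply hd
        rw [Prod.dist_eq]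
        exact max_le (hdist j hj) (by simp)
      have hdiag : dist (H (unitFrac M j, unitFrac M k))
          (H (unitFrac M (j + 1), unitFrac M (k + 1))) < ε := by
        apply hd
        rw [Prod.dist_eq]
        exact max_le (hdist j hj) (hdist k hk)
      have e1 : V (j + 1) (k + 1) =
        (V (j + 1) k).snoc (H (unitFrac M (j + 1), unitFrac M (k + 1))) := rfl
      have e2 : V j (k + 1) = (V j k).snoc (H (unitFrac M j, unitFrac M (k + 1))) := rfl
      rw [e1, ih (by omega), e2, EpsCover.snoc_snoc, EpsCover.snoc_snoc]
      all_goals try rw [hVfst j k (by omega)]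
      · exact hrow j k hk
      · exact hcol (k + 1)
      · exact hdiag
      · exact hcol k
      · exact hrow (j + 1) k hk
      · exact hdiag
  have hcol : ∀ j ≤ M, V j M = V 0 M := by
    intro j
    induction j with
    | zero => intro _; rfl
    | succ j ih =>
      intro hj
      rw [hV j hj M le_rfl, EpsCover.snoc_self hε, ih (by omega)]
      rw [hVfst j M le_rfl, unitFrac_self hM]
      simp
  have hmod : ∀ j, ∀ s t : I, dist s t ≤ 1 / (M : ℝ) →
      dist (H (unitFrac M j, s)) (H (unitFrac M j, t)) < ε := by
    intro j s t hst
    apply hd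
    rw [Prod.dist_eq]
    exact max_le (by simp) hst
  have hm0 := hmod 0
  have hm1 := hmod M
  have hc := hcol M le_rfl
  simp only [V, unitFrac_zero hM, unitFrac_self hM, ContinuousMap.HomotopyWith.apply_zero,
    ContinuousMap.HomotopyWith.apply_one] at hm0 hm1 hc
  have e0 := mk_eq_ofSeq c hα hε hM hm0
  have e1 := mk_eq_ofSeq c' hα' hε hM hm1
  have e2 : (⟨y, ChainClass.mk α⟩ : EpsCover ε x) = ⟨y, ChainClass.mk α'⟩ :=
    e0.trans (hc.symm.trans e1.symm)
  exact ChainClass.mk_eq_mk.1 (eq_of_heq (EpsCover.mk.inj e2).2)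

/-- The map `Λ`: it sends `[c]` to `[c(t₀), …, c(tₙ)]_ε` for any sufficiently fine subdivision
of `[0, 1]`; see `chainMap_mk` for the independence of all choices. -/
def chainMap {X : Type*} [MetricSpace X] {ε : ℝ} (hε : 0 < ε) {x y : X}
    (q : Path.Homotopic.Quotient x y) : ChainClass ε x y :=
  Quotient.liftOn q (fun c => ChainClass.mk (exists_isSubdivisionChain hε c).choose)
    fun c c' h => ChainClass.mk_eq_mk.2 <| homotopic_of_isSubdivisionChain hε h
      (exists_isSubdivisionChain hε c).choose_spec (exists_isSubdivisionChain hε c').choose_spec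

theorem chainMap_mk {X : Type*} [MetricSpace X] {ε : ℝ} (hε : 0 < ε) {x y : X} (c : Path x y)
    (α : EpsChain ε x y) (hα : IsSubdivisionChain c α) :
    chainMap hε (Path.Homotopic.Quotient.mk c) = ChainClass.mk α :=
  ChainClass.mk_eq_mk.2 <| homotopic_of_isSubdivisionChain hε (Path.Homotopic.refl c)
      (exists_isSubdivisionChain hε c).choose_spec hα

end

end DiscreteHomotopy

open DiscreteHomotopy

/-!
By compactness there is a scale `r` such that every loop inside an `r`-ball of `X` is
null-homotopic. At scales at most `r / 2`, replacing each jump of a chain by a geodesic therefore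
turns basic moves into homotopies and inverts `Λ`, so no such scale is critical. A loop which is
null at some scale is null at every smaller scale unless a critical value lies in between, which
carries the injectivity of `Λ`, and with it everything else about `X_ε`, from small `ε` to every
positive lower bound of the spectrum.

Every path class of length `L < N r / 4` contains a geodesic polygon with `N` sides of length at
most `r / 4` which is not longer than the given path. The vertices range over the compact space
`X ^ ℕ`, and polygons with uniformly close vertices are homotopic, so the length attains its minimum
in every fixed-endpoint and in every free homotopy class. A minimizer run with constant speed is
locally a geodesic, since any shorter replacement of a small piece would stay in its class; for
loops the piece may also cross the base point.
-/

namespace DiscreteHomotopy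

open scoped NNReal

/-! ### Lengths of paths -/

section Length

variable {X : Type*} [MetricSpace X] {x y z : X}

theorem range_eq_Icc_of_monotone {f : I → I} (hf : Monotone f) (hc : Continuous f) :
    Set.range f = Set.Icc (f 0) (f 1) := by
  refine subset_antisymm ?_ (intermediate_value_univ 0 1 hc)
  rintro _ ⟨t, rfl⟩
  exact ⟨hf unitInterval.nonneg', hf unitInterval.le_one'⟩

theorem pathLength_eq_of_comp (c : Path x y) (g : I → X) {f : I → I} (hf : Monotone f)
    (hfc : Continuous f) (h : ∀ t, c t = g (f t)) :
    pathLength c = eVariationOn g (Set.Icc (f 0) (f 1)) := by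
  rw [← range_eq_Icc_of_monotone hf hfc, ← Set.image_univ,
    ← eVariationOn.comp_eq_of_monotoneOn g f (hf.monotoneOn _)]
  exact congrArg (eVariationOn · Set.univ) (funext h)

theorem pathLength_eq (c : Path x y) : pathLength c = eVariationOn c (Set.Icc 0 1) :=
  pathLength_eq_of_comp c c monotone_id continuous_id fun _ => rfl

theorem pathLength_subpath (c : Path x y) {s t : I} (hst : s ≤ t) :
    pathLength (c.subpath s t) = eVariationOn c (Set.Icc s t) := by
  have hmono : Monotone (Set.Icc.convexComb s t) := fun a b hab => by
    rw [← Subtype.coe_le_coe, Set.Icc.coe_convexComb, Set.Icc.coe_convexComb]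
    nlinarith [Subtype.coe_le_coe.2 hst, Subtype.coe_le_coe.2 hab]
  have h := pathLength_eq_of_comp (c.subpath s t) c hmono (by fun_prop) fun _ => rfl
  simpa using h

theorem dist_eq_sub_of_le {s t : I} (h : s ≤ t) : dist s t = t - s := by
  rw [dist_comm, Subtype.dist_eq, Real.dist_eq,
    abs_of_nonneg (sub_nonneg.2 (Subtype.coe_le_coe.2 h))]

theorem eVariationOn_le_of_lipschitzWith {c : I → X} {K : ℝ≥0} (h : LipschitzWith K c) {s t : I}
    (hst : s ≤ t) : eVariationOn c (Set.Icc s t) ≤ K * edist s t := by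
  have hid : eVariationOn (id : I → I) (Set.Icc s t) = edist s t := by
    have hmono : MonotoneOn (fun u : I => (u : ℝ)) (Set.Icc s t) := fun _ _ _ _ huv => huv
    have hval := hmono.eVariationOn_eq (Set.left_mem_Icc.2 hst) (Set.right_mem_Icc.2 hst)
    rw [Set.inter_self] at hval
    rw [edist_dist, dist_eq_sub_of_le hst, ← hval]
    rfl
  rw [← hid]
  exact h.lipschitzOnWith.comp_eVariationOn_le (g := id) (Set.mapsTo_univ _ _)

theorem pathLength_le_of_lipschitzWith {c : Path x y} {K : ℝ≥0} (h : LipschitzWith K c) :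
    pathLength c ≤ K := by
  rw [pathLength_eq]
  simpa [edist_dist, Subtype.dist_eq] using eVariationOn_le_of_lipschitzWith h (zero_le_one' I)

theorem eVariationOn_Icc_add_Icc (c : I → X) {s t u : I} (hst : s ≤ t) (htu : t ≤ u) :
    eVariationOn c (Set.Icc s t) + eVariationOn c (Set.Icc t u) = eVariationOn c (Set.Icc s u) := by
  simpa using eVariationOn.Icc_add_Icc c (s := Set.univ) hst htu (Set.mem_univ t)

theorem edist_le_eVariationOn (c : I → X) {s t : I} (hst : s ≤ t) :
    edist (c s) (c t) ≤ eVariationOn c (Set.Icc s t) :=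
  eVariationOn.edist_le c (Set.left_mem_Icc.2 hst) (Set.right_mem_Icc.2 hst)

theorem isConstantPath_of_pathLength_eq_zero (c : Path x y) (h : pathLength c = 0) :
    IsConstantPath c := by
  intro t
  have ht : edist (c t) (c 0) ≤ pathLength c :=
    eVariationOn.edist_le _ (Set.mem_univ _) (Set.mem_univ _)
  rwa [h, nonpos_iff_eq_zero, edist_eq_zero, c.source] at ht

/-- The point `t / 2` of the unit interval, at which the first half of a concatenation takes the
value of its first path at `t`. -/
noncomputable def halfLeft (t : I) : I :=
  ⟨t / 2, by linarith [t.2.1], by linarith [t.2.2]⟩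

/-- The point `(1 + t) / 2` of the unit interval, at which the second half of a concatenation takes
the value of its second path at `t`. -/
noncomputable def halfRight (t : I) : I :=
  ⟨(1 + t) / 2, by linarith [t.2.1], by linarith [t.2.2]⟩

theorem trans_halfLeft {Y : Type*} [TopologicalSpace Y] {x y z : Y} (c : Path x y) (d : Path y z)
    (t : I) : c.trans d (halfLeft t) = c t := by
  rw [Path.trans_apply, dif_pos (by simp only [halfLeft]; linarith [t.2.2])]
  congr 1
  ext
  simp only [halfLeft]
  ring

theorem trans_halfRight {Y : Type*} [TopologicalSpace Y] {x y z : Y} (c : Path x y) (d : Path y z)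
    (t : I) : c.trans d (halfRight t) = d t := by
  have hσ : halfRight t = σ (halfLeft (σ t)) := by
    ext
    simp only [halfRight, halfLeft, unitInterval.coe_symm_eq]
    ring
  have h := trans_halfLeft d.symm c.symm (σ t)
  rwa [← Path.trans_symm, Path.symm_apply, Path.symm_apply, Function.comp_apply,
    Function.comp_apply, unitInterval.symm_symm, ← hσ] at h

theorem dist_halfLeft (s t : I) : dist (halfLeft s) (halfLeft t) = dist s t / 2 := by
  simp only [halfLeft, Subtype.dist_eq, Real.dist_eq, ← sub_div, abs_div, abs_two]

theorem dist_halfRight (s t : I) : dist (halfRight s) (halfRight t) = dist s t / 2 := by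
  simp only [halfRight, Subtype.dist_eq, Real.dist_eq, ← sub_div, abs_div, abs_two,
    add_sub_add_left_eq_sub]

theorem pathLength_trans (c : Path x y) (d : Path y z) :
    pathLength (c.trans d) = pathLength c + pathLength d := by
  have hL : Monotone halfLeft := fun s t hst =>
    Subtype.coe_le_coe.1 (div_le_div_of_nonneg_right (Subtype.coe_le_coe.2 hst) zero_le_two)
  have hR : Monotone halfRight := fun s t hst => Subtype.coe_le_coe.1
    (div_le_div_of_nonneg_right (add_le_add_right (Subtype.coe_le_coe.2 hst) 1) zero_le_two)
  have hmid : halfLeft 1 = halfRight 0 := by ext; simp [halfLeft, halfRight]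
  have h0 : halfLeft 0 = 0 := by ext; simp [halfLeft]
  have h1 : halfRight 1 = 1 := by ext; simp [halfRight]
  rw [pathLength_eq_of_comp c (c.trans d) hL (by unfold halfLeft; fun_prop)
      fun t => (trans_halfLeft c d t).symm,
    pathLength_eq_of_comp d (c.trans d) hR (by unfold halfRight; fun_prop)
      fun t => (trans_halfRight c d t).symm,
    ← hmid, eVariationOn_Icc_add_Icc _ (hL zero_le_one) (by rw [hmid]; exact hR zero_le_one),
    h0, h1, pathLength_eq]

end Length

/-! ### Geodesics and small loops -/

section Geodesic

variable {X : Type*} [MetricSpace X]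

theorem IsGeodesicSpace.exists_path (hgeo : IsGeodesicSpace X) (x y : X) :
    ∃ c : Path x y, ∀ s t : I, dist (c s) (c t) = dist x y * dist s t := by
  obtain ⟨γ, h0, h1, h⟩ := hgeo x y
  have hmem (t : I) : dist x y * (t : ℝ) ∈ Set.Icc 0 (dist x y) :=
    ⟨mul_nonneg dist_nonneg t.2.1, mul_le_of_le_one_right dist_nonneg t.2.2⟩
  have hd (s t : I) : dist (γ (dist x y * s)) (γ (dist x y * t)) = dist x y * dist s t := by
    rw [h _ (hmem s) _ (hmem t), ← mul_sub, abs_mul, abs_of_nonneg dist_nonneg, Subtype.dist_eq,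
      Real.dist_eq]
  have hcont : Continuous fun t : I => γ (dist x y * t) :=
    (LipschitzWith.of_dist_le_mul (K := nndist x y) fun s t => (hd s t).le).continuous
  exact ⟨⟨⟨_, hcont⟩, by simp [h0], by simp [h1]⟩, hd⟩

/-- A chosen shortest path with constant speed between two points of a geodesic space. -/
noncomputable def IsGeodesicSpace.path (hgeo : IsGeodesicSpace X) (x y : X) : Path x y :=
  (hgeo.exists_path x y).choose

variable (hgeo : IsGeodesicSpace X) {r : ℝ}

theorem IsGeodesicSpace.dist_path (x y : X) (s t : I) :
    dist (hgeo.path x y s) (hgeo.path x y t) = dist x y * dist s t :=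
  (hgeo.exists_path x y).choose_spec s t

theorem IsGeodesicSpace.dist_source_path (x y : X) (t : I) :
    dist x (hgeo.path x y t) ≤ dist x y := by
  have h := hgeo.dist_path x y 0 t
  rw [Path.source] at h
  exact h.trans_le (mul_le_of_le_one_right dist_nonneg (Real.dist_le_of_mem_Icc_01 (0 : I).2 t.2))

theorem IsGeodesicSpace.path_self (x : X) : hgeo.path x x = Path.refl x := by
  ext t
  exact (dist_le_zero.1 ((hgeo.dist_source_path x x t).trans_eq (dist_self x))).symm

theorem IsGeodesicSpace.range_path_subset {x y z : X} (h : dist z x + dist x y < r) :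
    Set.range (hgeo.path x y) ⊆ Metric.ball z r := by
  rintro _ ⟨t, rfl⟩
  rw [Metric.mem_ball, dist_comm]
  linarith [hgeo.dist_source_path x y t, dist_triangle z x (hgeo.path x y t)]

theorem IsGeodesicSpace.pathLength_path_le (x y : X) :
    pathLength (hgeo.path x y) ≤ edist x y :=
  edist_nndist x y ▸ pathLength_le_of_lipschitzWith
    (LipschitzWith.of_dist_le_mul fun s t => (hgeo.dist_path x y s t).le)

/-- All loops that stay in a ball of radius `r` are null-homotopic: the uniform version of
semilocal simple connectedness that compactness provides. -/
def LoopsNullInBalls (X : Type*) [MetricSpace X] (r : ℝ) : Prop :=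
  ∀ (z x : X) (c : Path x x), Set.range c ⊆ Metric.ball z r → c.Homotopic (Path.refl x)

theorem quotient_eq_of_trans_symm {Y : Type*} [TopologicalSpace Y] {x y : Y}
    {p q : Path.Homotopic.Quotient x y} (h : p.trans q.symm = .refl x) : p = q := by
  calc p = (p.trans q.symm).trans q := by simp
    _ = q := by rw [h]; simp

theorem homotopic_refl_of_conj {Y : Type*} [TopologicalSpace Y] {x y : Y} {e : Path x y}
    {c : Path y y} (h : ((e.trans c).trans e.symm).Homotopic (Path.refl x)) :
    c.Homotopic (Path.refl y) := by
  rw [← Path.Homotopic.Quotient.eq] at h ⊢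
  simp only [Path.Homotopic.Quotient.mk_trans, Path.Homotopic.Quotient.mk_symm,
    Path.Homotopic.Quotient.mk_refl] at h ⊢
  calc Path.Homotopic.Quotient.mk c
      = (Path.Homotopic.Quotient.mk e).symm.trans
          ((Path.Homotopic.Quotient.mk e).trans (.mk c)) := by
        rw [← Path.Homotopic.Quotient.trans_assoc]; simp
    _ = .refl y := by rw [quotient_eq_of_trans_symm h]; simp

theorem range_trans_subset {Y : Type*} [TopologicalSpace Y] {x y z : Y} {c : Path x y}
    {d : Path y z} {s : Set Y} (hc : Set.range c ⊆ s) (hd : Set.range d ⊆ s) :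
    Set.range (c.trans d) ⊆ s := by
  rw [Path.trans_range]
  exact Set.union_subset hc hd

theorem LoopsNullInBalls.homotopic (hr : LoopsNullInBalls X r) {x y z : X} {c d : Path x y}
    (hc : Set.range c ⊆ Metric.ball z r) (hd : Set.range d ⊆ Metric.ball z r) :
    c.Homotopic d := by
  have h := hr z x (c.trans d.symm) (range_trans_subset hc (by rwa [Path.symm_range]))
  rw [← Path.Homotopic.Quotient.eq] at h ⊢
  exact quotient_eq_of_trans_symm (by simpa using h)

theorem exists_ball_loops_null (hgeo : IsGeodesicSpace X) (hslsc : IsSemilocallySimplyConnected X)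
    (x : X) : ∃ r : ℝ, 0 < r ∧ ∀ (w : X) (c : Path w w),
      Set.range c ⊆ Metric.ball x r → c.Homotopic (Path.refl w) := by
  obtain ⟨U, hU, hnull⟩ := hslsc x
  obtain ⟨r, hr, hrU⟩ := Metric.mem_nhds_iff.1 hU
  refine ⟨r, hr, fun w c hc => ?_⟩
  have hw : dist w x < r := hc ⟨0, c.source⟩
  have he : Set.range (hgeo.path x w) ⊆ Metric.ball x r :=
    hgeo.range_path_subset (by rwa [dist_self, zero_add, dist_comm])
  exact homotopic_refl_of_conj (hnull _ ((range_trans_subset (range_trans_subset he hc)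
    (by rwa [Path.symm_range])).trans hrU))

theorem exists_loopsNullInBalls [CompactSpace X] (hgeo : IsGeodesicSpace X)
    (hslsc : IsSemilocallySimplyConnected X) : ∃ r : ℝ, 0 < r ∧ LoopsNullInBalls X r := by
  choose ρ hρ hnull using exists_ball_loops_null hgeo hslsc
  obtain ⟨r, hr, hball⟩ := lebesgue_number_lemma_of_metric (s := (Set.univ : Set X))
    (c := fun x => Metric.ball x (ρ x)) isCompact_univ (fun _ => Metric.isOpen_ball)
    fun x _ => Set.mem_iUnion.2 ⟨x, Metric.mem_ball_self (hρ x)⟩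
  refine ⟨r, hr, fun z x c hc => ?_⟩
  obtain ⟨i, hi⟩ := hball z (Set.mem_univ z)
  exact hnull i x c (hc.trans hi)

end Geodesic

/-! ### Polygons of geodesics and their homotopy classes -/

/-- Homotopy classes of paths starting at `p`, with arbitrary endpoints: the analogue of `EpsCover`
for paths, i.e. the points of the classical universal cover. -/
structure PathCover {X : Type*} [TopologicalSpace X] (p : X) where
  endpoint : X
  cls : Path.Homotopic.Quotient p endpoint

namespace PathCover

section

variable {X : Type*} [MetricSpace X] (hgeo : IsGeodesicSpace X) {r : ℝ} {p x y z : X}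

theorem mk_eq_mk_iff {q q' : Path.Homotopic.Quotient x y} :
    (⟨y, q⟩ : PathCover x) = ⟨y, q'⟩ ↔ q = q' :=
  ⟨fun h => eq_of_heq (PathCover.mk.inj h).2, fun h => h ▸ rfl⟩

theorem mk_eq_mk_of_apply_eq {c : Path x y} {c' : Path x z} (h : ∀ t, c t = c' t) :
    (⟨y, .mk c⟩ : PathCover x) = ⟨z, .mk c'⟩ := by
  obtain rfl : y = z := by simpa using h 1
  obtain rfl : c = c' := Path.ext (funext h)
  rfl

theorem exists_eq_of_endpoint_eq {w : PathCover x} (h : w.endpoint = y) :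
    ∃ q : Path.Homotopic.Quotient x y, w = ⟨y, q⟩ := by
  subst h
  exact ⟨w.cls, rfl⟩

/-- The class of the constant path: the base point of the cover. -/
def base (p : X) : PathCover p := ⟨p, .refl p⟩

/-- Append the chosen geodesic to `z` to a class of paths; compare `EpsCover.snoc`. -/
noncomputable def snoc (a : PathCover p) (z : X) : PathCover p :=
  ⟨z, a.cls.trans (.mk (hgeo.path a.endpoint z))⟩

theorem snoc_self {a : PathCover p} (h : a.endpoint = z) : a.snoc hgeo z = a := by
  subst h
  obtain ⟨y, q⟩ := a
  rw [snoc, hgeo.path_self]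
  exact mk_eq_mk_iff.2 (Path.Homotopic.Quotient.trans_refl q)

theorem snoc_snoc (hr : LoopsNullInBalls X r) {a : PathCover p} {z w : X}
    (h : dist a.endpoint z + dist z w < r) :
    (a.snoc hgeo z).snoc hgeo w = a.snoc hgeo w := by
  have hhom : ((hgeo.path a.endpoint z).trans (hgeo.path z w)).Homotopic
      (hgeo.path a.endpoint w) := by
    refine hr.homotopic (z := a.endpoint) (range_trans_subset ?_ ?_) ?_ <;>
      apply hgeo.range_path_subset <;>
      linarith [dist_self a.endpoint, dist_triangle a.endpoint z w, dist_nonneg (x := z) (y := w)]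
  rw [← Path.Homotopic.Quotient.eq, Path.Homotopic.Quotient.mk_trans] at hhom
  simp only [snoc, Path.Homotopic.Quotient.trans_assoc, hhom]

/-- Append successively the geodesics to the points of a list: the class of a polygon. -/
noncomputable def trace (a : PathCover p) (l : List X) : PathCover p :=
  l.foldl (snoc hgeo) a

@[simp]
theorem trace_cons (a : PathCover p) (z : X) (l : List X) :
    a.trace hgeo (z :: l) = (a.snoc hgeo z).trace hgeo l := rfl

theorem trace_append (a : PathCover p) (l l' : List X) :
    a.trace hgeo (l ++ l') = (a.trace hgeo l).trace hgeo l' := List.foldl_append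

theorem endpoint_trace (a : PathCover p) (l : List X) :
    (a.trace hgeo l).endpoint = (a.endpoint :: l).getLast (List.cons_ne_nil _ _) := by
  induction l generalizing a with
  | nil => rfl
  | cons b l ih => rw [trace_cons, ih, List.getLast_cons_cons]; rfl

theorem rel_endpoint_trace {R : X → X → Prop} {a : PathCover p} {l l' : List X} {q : X}
    (h : (a.endpoint :: (l ++ q :: l')).IsChain R) : R (a.trace hgeo l).endpoint q := by
  induction l generalizing a with
  | nil => exact (List.isChain_cons_cons.1 h).1
  | cons b l ih => exact ih (a := a.snoc hgeo b) (List.isChain_cons_cons.1 h).2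

/-- Append successively the geodesics to `f 1, …, f n`; the vertex `f 0` is meant to be the endpoint
of `a`. -/
noncomputable def walk (a : PathCover p) (f : ℕ → X) (n : ℕ) : PathCover p :=
  a.trace hgeo ((List.range n).map fun i => f (i + 1))

theorem walk_succ (a : PathCover p) (f : ℕ → X) (n : ℕ) :
    a.walk hgeo f (n + 1) = (a.walk hgeo f n).snoc hgeo (f (n + 1)) := by
  simp only [walk, List.range_succ, List.map_append, trace_append]
  rfl

theorem endpoint_walk {a : PathCover p} {f : ℕ → X} (h : a.endpoint = f 0) (n : ℕ) :
    (a.walk hgeo f n).endpoint = f n := by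
  cases n with
  | zero => exact h
  | succ n => rw [walk_succ]; rfl

/-- Precompose with a class of paths: a deck transformation of the cover if `a` is a loop class. -/
noncomputable def translate (a : PathCover p) (b : PathCover a.endpoint) : PathCover p :=
  ⟨b.endpoint, a.cls.trans b.cls⟩

theorem translate_base (a : PathCover p) : a.translate (base a.endpoint) = a := by
  simp [translate, base]

theorem translate_snoc (a : PathCover p) (b : PathCover a.endpoint) (z : X) :
    (a.translate b).snoc hgeo z = a.translate (b.snoc hgeo z) := by
  simp [translate, snoc, Path.Homotopic.Quotient.trans_assoc]

theorem translate_trace (a : PathCover p) (b : PathCover a.endpoint) (l : List X) :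
    (a.translate b).trace hgeo l = a.translate (b.trace hgeo l) := by
  induction l generalizing b with
  | nil => rfl
  | cons z l ih => rw [trace_cons, trace_cons, translate_snoc, ih]

theorem walk_eq_translate (a : PathCover p) (f : ℕ → X) (n : ℕ) :
    a.walk hgeo f n = a.translate ((base a.endpoint).walk hgeo f n) := by
  rw [walk, walk, ← translate_trace, translate_base]

theorem walk_snoc_eq (hr : LoopsNullInBalls X r) {η : ℝ} (hη : 2 * η ≤ r) {a : PathCover p}
    {f g : ℕ → X} (ha : a.endpoint = f 0) {n : ℕ} (hfg : ∀ i ≤ n, dist (f i) (g i) < η)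
    (hf : ∀ i < n, dist (f i) (f (i + 1)) < η) (hg : ∀ i < n, dist (g i) (g (i + 1)) < η) :
    (a.walk hgeo f n).snoc hgeo (g n) = (a.snoc hgeo (g 0)).walk hgeo g n := by
  induction n with
  | zero => rfl
  | succ n ih =>
    rw [walk_succ, walk_succ, ← ih (fun i hi => hfg i (by omega)) (fun i hi => hf i (by omega))
      fun i hi => hg i (by omega), snoc_snoc hgeo hr, snoc_snoc hgeo hr]
    · rw [endpoint_walk hgeo ha]
      linarith [hfg n (by omega), hg n (by omega)]
    · rw [endpoint_walk hgeo ha]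
      linarith [hf n (by omega), hfg (n + 1) le_rfl]

theorem mk_subpath_snoc (hr : LoopsNullInBalls X r) (c : Path x y) {s t : I} (hst : s ≤ t)
    (hball : ∀ u ∈ Set.Icc s t, dist (c s) (c u) < r) :
    snoc hgeo ⟨c s, .mk ((c.subpath 0 s).cast c.source.symm rfl)⟩ (c t) =
      ⟨c t, .mk ((c.subpath 0 t).cast c.source.symm rfl)⟩ := by
  have hgeod : (hgeo.path (c s) (c t)).Homotopic (c.subpath s t) := by
    refine hr.homotopic (z := c s) (hgeo.range_path_subset ?_) ?_
    · rw [dist_self, zero_add]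
      exact hball t ⟨hst, le_rfl⟩
    · rw [Path.range_subpath_of_le _ _ _ hst]
      rintro _ ⟨u, hu, rfl⟩
      rw [Metric.mem_ball, dist_comm]
      exact hball u hu
  have htrans : (((c.subpath 0 s).cast c.source.symm rfl).trans (hgeo.path (c s) (c t))).Homotopic
      ((c.subpath 0 t).cast c.source.symm rfl) :=
    ((Path.Homotopic.refl _).hcomp hgeod).trans ⟨Path.Homotopy.subpathTransSubpath c 0 s t⟩
  exact mk_eq_mk_iff.2 (Path.Homotopic.Quotient.eq.2 htrans)

theorem walk_eq_mk (hr : LoopsNullInBalls X r) (c : Path x y) {t : ℕ → I} {n : ℕ} (ht0 : t 0 = 0)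
    (htn : t n = 1) (hle : ∀ i < n, t i ≤ t (i + 1))
    (hball : ∀ i < n, ∀ s ∈ Set.Icc (t i) (t (i + 1)), dist (c (t i)) (c s) < r) :
    (base x).walk hgeo (fun i => c (t i)) n = ⟨y, .mk c⟩ := by
  have hwalk (i : ℕ) (hi : i ≤ n) : (base x).walk hgeo (fun i => c (t i)) i =
      ⟨c (t i), .mk ((c.subpath 0 (t i)).cast c.source.symm rfl)⟩ := by
    induction i with
    | zero =>
      refine mk_eq_mk_of_apply_eq (c := Path.refl x) fun s => ?_
      rw [Path.cast_coe, ht0, Path.subpath_self]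
      simp
    | succ i ih =>
      rw [walk_succ, ih (by omega)]
      exact mk_subpath_snoc hgeo hr c (hle i hi) (hball i hi)
  rw [hwalk n le_rfl]
  refine mk_eq_mk_of_apply_eq fun s => ?_
  rw [Path.cast_coe, htn, Path.subpath_zero_one, Path.cast_coe]

theorem listLength_nonneg (l : List X) : 0 ≤ listLength l := by
  induction l with
  | nil => exact le_rfl
  | cons a l ih =>
    cases l with
    | nil => exact le_rfl
    | cons b l => exact add_nonneg dist_nonneg ih

theorem exists_path_trace (l : List X) (a : PathCover p) (c : Path p a.endpoint)
    (hc : Path.Homotopic.Quotient.mk c = a.cls) :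
    ∃ c' : Path p (a.trace hgeo l).endpoint,
      Path.Homotopic.Quotient.mk c' = (a.trace hgeo l).cls ∧
      pathLength c' ≤ pathLength c + ENNReal.ofReal (listLength (a.endpoint :: l)) := by
  induction l generalizing a with
  | nil => exact ⟨c, hc, le_self_add⟩
  | cons b l ih =>
    have hd : Path.Homotopic.Quotient.mk (c.trans (hgeo.path a.endpoint b)) =
        (a.snoc hgeo b).cls := by
      rw [Path.Homotopic.Quotient.mk_trans, hc]
      rfl
    have hlen : pathLength (c.trans (hgeo.path a.endpoint b)) ≤
        pathLength c + ENNReal.ofReal (dist a.endpoint b) := by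
      rw [pathLength_trans, ← edist_dist]
      gcongr
      exact hgeo.pathLength_path_le _ _
    obtain ⟨c', hc', hle⟩ := ih (a.snoc hgeo b) _ hd
    refine ⟨c', hc', hle.trans ?_⟩
    rw [listLength, ENNReal.ofReal_add dist_nonneg (listLength_nonneg _), ← add_assoc]
    exact add_le_add_left hlen _

theorem exists_path_trace_base {l : List X} {q : Path.Homotopic.Quotient x y}
    (h : (base x).trace hgeo l = ⟨y, q⟩) : ∃ c : Path x y,
      Path.Homotopic.Quotient.mk c = q ∧ pathLength c ≤ ENNReal.ofReal (listLength (x :: l)) := by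
  have hrefl : pathLength (Path.refl x) = 0 := (eVariationOn.eq_zero_iff _).2 (by simp)
  have hpath := exists_path_trace hgeo l (base x) (Path.refl x) rfl
  rw [h] at hpath
  simpa only [base, hrefl, zero_add] using hpath

variable {ε : ℝ}

theorem trace_insert (hr : LoopsNullInBalls X r) (hε : 2 * ε ≤ r) {a : PathCover p}
    {l l' : List X} {q : X} (h : (a.endpoint :: (l ++ q :: l')).IsChain (fun y z => dist y z < ε))
    (hnil : l' = [] → (a.trace hgeo l).endpoint = q) :
    a.trace hgeo (l ++ q :: l') = a.trace hgeo (l ++ l') := by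
  rw [trace_append, trace_append, trace_cons]
  cases l' with
  | nil => rw [snoc_self hgeo (hnil rfl)]
  | cons w l' =>
    have hq := rel_endpoint_trace hgeo h
    have hw : dist q w < ε := by
      rw [← List.cons_append, List.isChain_append] at h
      exact (List.isChain_cons_cons.1 h.2.1).1
    rw [trace_cons, trace_cons, snoc_snoc hgeo hr (by linarith)]

theorem trace_eq_of_insertPoint (hr : LoopsNullInBalls X r) (hε : 2 * ε ≤ r)
    {α β : EpsChain ε x y} (h : InsertPoint α.points β.points) :
    (base x).trace hgeo α.tail = (base x).trace hgeo β.tail := by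
  obtain ⟨l, l', q, hα, hβ⟩ := h
  cases l with
  | nil =>
    obtain ⟨rfl, hβ'⟩ := List.cons.inj hβ
    obtain rfl : _ = l' := hα
    rw [show β.tail = x :: α.tail from hβ', trace_cons,
      snoc_self hgeo (z := x) (a := base x) rfl]
  | cons _ l =>
    obtain ⟨rfl, hα'⟩ := List.cons.inj hα
    have hβ' : β.tail = l ++ q :: l' := (List.cons.inj hβ).2
    rw [show α.tail = l ++ l' from hα', hβ']
    refine (trace_insert hgeo hr hε (hβ' ▸ β.isChain) ?_).symm
    rintro rfl
    have hαy := α.getLast_eq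
    have hβy := β.getLast_eq
    simp only [hβ'] at hβy
    simp only [show α.tail = l ++ [] from hα', List.append_nil] at hαy
    rw [endpoint_trace]
    exact hαy.trans (hβy.symm.trans (by simp))

theorem trace_eq_of_homotopic (hr : LoopsNullInBalls X r) (hε : 2 * ε ≤ r) {α β : EpsChain ε x y}
    (h : α.Homotopic β) : (base x).trace hgeo α.tail = (base x).trace hgeo β.tail := by
  induction h with
  | refl => rfl
  | tail _ h ih =>
    exact ih.trans (h.elim (trace_eq_of_insertPoint hgeo hr hε)
      fun h => (trace_eq_of_insertPoint hgeo hr hε h).symm)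

theorem exists_trace_tail_eq_mk (α : EpsChain ε x y) : ∃ c : Path x y,
    (base x).trace hgeo α.tail = ⟨y, .mk c⟩ ∧ pathLength c ≤ ENNReal.ofReal α.length := by
  obtain ⟨q, hq⟩ : ∃ q, (base x).trace hgeo α.tail = ⟨y, q⟩ := by
    have hy := (endpoint_trace hgeo (base x) α.tail).trans α.getLast_eq
    exact exists_eq_of_endpoint_eq hy
  obtain ⟨c, rfl, hc⟩ := exists_path_trace_base hgeo hq
  exact ⟨c, hq, hc⟩

theorem trace_of_isSubdivisionChain (hr : LoopsNullInBalls X r) (hε : ε ≤ r) {c : Path x y}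
    {α : EpsChain ε x y} (hα : IsSubdivisionChain c α) :
    (base x).trace hgeo α.tail = ⟨y, .mk c⟩ := by
  obtain ⟨n, t, ht0, htn, hlt, hball, hpts⟩ := hα
  rw [← walk_eq_mk hgeo hr c ht0 htn (fun i hi => (hlt i hi).le) fun i hi s hs => by
    have := hball i hi s hs
    rw [Metric.mem_ball, dist_comm] at this
    linarith]
  rw [walk]
  congr 1
  rw [List.range_succ_eq_map, List.map_cons, List.map_map] at hpts
  exact (List.cons.inj hpts).2

end

end PathCover

/-! ### The map `Λ`, concatenation and polygons -/

theorem unitFrac_add_self {M i : ℕ} (hM : 0 < M) (hi : i ≤ M) :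
    unitFrac (M + M) i = halfLeft (unitFrac M i) := by
  ext
  simp only [halfLeft]
  rw [coe_unitFrac hM hi, coe_unitFrac (by omega) (by omega)]
  push_cast
  field_simp
  ring

theorem unitFrac_add_self_add {M j : ℕ} (hM : 0 < M) (hj : j ≤ M) :
    unitFrac (M + M) (M + j) = halfRight (unitFrac M j) := by
  ext
  simp only [halfRight]
  rw [coe_unitFrac hM hj, coe_unitFrac (by omega) (by omega)]
  push_cast
  field_simp
  ring

namespace ChainClass

variable {X : Type*} [MetricSpace X] {ε : ℝ} {x y : X}

theorem eq_of_concat_reverse_eq_one {a b : ChainClass ε x y} (h : a.concat b.reverse = one ε x) :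
    a = b := by
  rw [← one_concat b, ← h, concat_assoc, reverse_concat_self, concat_one]

theorem exists_length_lt {a : ChainClass ε x y} {r : ℝ} (h : a.norm < r) :
    ∃ γ : EpsChain ε x y, mk γ = a ∧ γ.length < r := by
  contrapose! h
  exact le_norm h

end ChainClass

namespace EpsCover

variable {X : Type*} [MetricSpace X] {ε : ℝ} {x y : X}

theorem mk_eq_mk_iff {a b : ChainClass ε x y} :
    (⟨y, a⟩ : EpsCover ε x) = ⟨y, b⟩ ↔ a = b :=
  ⟨fun h => eq_of_heq (EpsCover.mk.inj h).2, fun h => h ▸ rfl⟩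

theorem ofSeq_congr {f g : ℕ → X} {n : ℕ} (h : ∀ i ≤ n, f i = g i) :
    ofSeq ε x f n = ofSeq ε x g n := by
  induction n with
  | zero => rfl
  | succ n ih => rw [ofSeq, ofSeq, ih fun i hi => h i (by omega), h (n + 1) le_rfl]

/-- Precompose with a class of chains: the deck transformation of `X_ε` if `a` is a loop class. -/
def translate (a : ChainClass ε x y) (b : EpsCover ε y) : EpsCover ε x :=
  ⟨b.endpoint, a.concat b.cls⟩

theorem translate_snoc (a : ChainClass ε x y) (b : EpsCover ε y) (z : X) :
    (translate a b).snoc z = translate a (b.snoc z) := by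
  by_cases h : dist b.endpoint z < ε
  · rw [snoc_eq h, snoc_eq (a := translate a b) h]
    simp only [translate, ChainClass.concat_assoc]
  · rw [snoc, snoc, dif_neg h]
    exact dif_neg h

theorem translate_ofSeq (a : ChainClass ε x y) (f g : ℕ → X) (m n : ℕ)
    (hf : ofSeq ε x f m = ⟨y, a⟩) (hfg : ∀ j ≤ n, f (m + j) = g j) :
    ofSeq ε x f (m + n) = translate a (ofSeq ε y g n) := by
  induction n with
  | zero => rw [add_zero, hf, ofSeq, translate, ChainClass.concat_one]
  | succ n ih =>
    rw [← add_assoc, ofSeq, ofSeq, ih fun j hj => hfg j (by omega), translate_snoc, add_assoc,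
      hfg _ le_rfl]

end EpsCover

section ChainMap

variable {X : Type*} [MetricSpace X] {ε : ℝ} {x y z : X}

theorem chainMap_eq_ofSeq (hε : 0 < ε) (c : Path x y) {M : ℕ} (hM : 0 < M)
    (h : ∀ s t : I, dist s t ≤ 1 / (M : ℝ) → dist (c s) (c t) < ε) :
    (⟨y, chainMap hε (.mk c)⟩ : EpsCover ε x) =
      EpsCover.ofSeq ε x (fun i => c (unitFrac M i)) M := by
  obtain ⟨α, hα⟩ := exists_isSubdivisionChain hε c
  rw [chainMap_mk hε c α hα]
  exact mk_eq_ofSeq c hα hε hM h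

theorem chainMap_trans (hε : 0 < ε) (q : Path.Homotopic.Quotient x y)
    (q' : Path.Homotopic.Quotient y z) :
    chainMap hε (q.trans q') = (chainMap hε q).concat (chainMap hε q') := by
  induction q using Path.Homotopic.Quotient.ind with | mk c
  induction q' using Path.Homotopic.Quotient.ind with | mk d
  rw [← Path.Homotopic.Quotient.mk_trans]
  obtain ⟨M, hM, h⟩ := exists_fine_modulus hε (c.trans d) (c.trans d).continuous
  have hc := chainMap_eq_ofSeq hε c hM fun s t hst => by
    rw [← trans_halfLeft c d, ← trans_halfLeft c d]
    exact h _ _ (by linarith [dist_halfLeft s t, dist_nonneg (x := s) (y := t)])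
  have hd := chainMap_eq_ofSeq hε d hM fun s t hst => by
    rw [← trans_halfRight c d, ← trans_halfRight c d]
    exact h _ _ (by linarith [dist_halfRight s t, dist_nonneg (x := s) (y := t)])
  have hcd := chainMap_eq_ofSeq hε (c.trans d) (M := M + M) (by omega) fun s t hst =>
    h s t (hst.trans (one_div_le_one_div_of_le (by exact_mod_cast hM) (by push_cast; linarith)))
  have hleft : ∀ i ≤ M, c.trans d (unitFrac (M + M) i) = c (unitFrac M i) := fun i hi => by
    rw [unitFrac_add_self hM hi, trans_halfLeft]
  have hright : ∀ j ≤ M, c.trans d (unitFrac (M + M) (M + j)) = d (unitFrac M j) := fun j hj => by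
    rw [unitFrac_add_self_add hM hj, trans_halfRight]
  rw [← EpsCover.ofSeq_congr hleft] at hc
  rw [EpsCover.translate_ofSeq _ _ _ M M hc.symm hright, ← hd] at hcd
  exact EpsCover.mk_eq_mk_iff.1 hcd

theorem chainMap_refl (hε : 0 < ε) (x : X) : chainMap hε (.refl x) = ChainClass.one ε x := by
  have h := chainMap_trans hε (.refl x) (.refl x)
  rw [Path.Homotopic.Quotient.refl_trans] at h
  exact left_eq_mul.1 h

variable (hgeo : IsGeodesicSpace X)
include hgeo

theorem chainMap_path (hε : 0 < ε) (h : dist x y < ε) :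
    chainMap hε (.mk (hgeo.path x y)) = .mk (EpsChain.pair h) := by
  refine chainMap_mk hε _ _ ⟨1, fun i => if i = 0 then 0 else 1, rfl, rfl, ?_, ?_, ?_⟩
  · intro i hi
    obtain rfl : i = 0 := by omega
    simp
  · intro i hi s _
    obtain rfl : i = 0 := by omega
    simp only [if_true, Path.source, Metric.mem_ball]
    rw [dist_comm]
    exact (hgeo.dist_source_path x y s).trans_lt h
  · simp [EpsChain.points, EpsChain.pair, List.range_succ]

theorem chainMap_trace (hε : 0 < ε) {p : X} {l : List X} {γ : EpsChain ε x y} (hγ : γ.tail = l)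
    (q : Path.Homotopic.Quotient p x) {q' : Path.Homotopic.Quotient p y}
    (h : (⟨x, q⟩ : PathCover p).trace hgeo l = ⟨y, q'⟩) :
    chainMap hε q' = (chainMap hε q).concat (.mk γ) := by
  induction l generalizing x with
  | nil =>
    obtain rfl : x = y := by simpa only [hγ, List.getLast_singleton] using γ.getLast_eq
    rw [EpsChain.eq_single_of_tail_nil γ hγ, ← PathCover.mk_eq_mk_iff.1 h]
    exact (ChainClass.concat_one _).symm
  | cons b l ih =>
    obtain ⟨hb, β, hβ, rfl⟩ := EpsChain.eq_pair_concat γ hγ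
    rw [ih hβ (q.trans (.mk (hgeo.path x b))) h, chainMap_trans, chainMap_path hgeo hε hb,
      ChainClass.concat_assoc]
    rfl

theorem chainMap_of_trace_base (hε : 0 < ε) (γ : EpsChain ε x y)
    {q : Path.Homotopic.Quotient x y}
    (h : (PathCover.base x).trace hgeo γ.tail = ⟨y, q⟩) : chainMap hε q = .mk γ := by
  rw [chainMap_trace hgeo hε rfl (.refl x) h, chainMap_refl, ChainClass.one_concat]

theorem chainMap_surjective (hε : 0 < ε) (x y : X) :
    Function.Surjective (chainMap hε : Path.Homotopic.Quotient x y → ChainClass ε x y) := by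
  intro a
  obtain ⟨α, rfl⟩ := ChainClass.mk_surjective a
  obtain ⟨c, hc, -⟩ := PathCover.exists_trace_tail_eq_mk hgeo α
  exact ⟨_, chainMap_of_trace_base hgeo hε α hc⟩

end ChainMap

/-! ### Lower bounds of the homotopy critical spectrum -/

namespace EpsChain

variable {X : Type*} [MetricSpace X] {ε δ r : ℝ} {x y z : X}

theorem Homotopic.ofLE {α β : EpsChain ε x y} (h : α.Homotopic β) (hε : ε ≤ δ) :
    (α.ofLE hε).Homotopic (β.ofLE hε) := by
  induction h with
  | refl => exact .refl _
  | tail _ h ih => exact .tail ih h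

theorem exists_lt_isChain {l : List X} (h : l.IsChain fun a b => dist a b < ε) (hδ : δ < ε) :
    ∃ δ', δ ≤ δ' ∧ δ' < ε ∧ l.IsChain fun a b => dist a b < δ' := by
  induction l with
  | nil => exact ⟨δ, le_rfl, hδ, .nil⟩
  | cons a l ih =>
    cases l with
    | nil => exact ⟨δ, le_rfl, hδ, .singleton _⟩
    | cons b l =>
      rw [List.isChain_cons_cons] at h
      obtain ⟨δ', hle, hlt, hl⟩ := ih h.2
      obtain ⟨η, hη, hηε⟩ := exists_between h.1
      exact ⟨max δ' η, hle.trans (le_max_left _ _), max_lt hlt hηε, List.isChain_cons_cons.2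
        ⟨hη.trans_le (le_max_right _ _), hl.imp fun _ _ h => h.trans_le (le_max_left _ _)⟩⟩

theorem Homotopic.exists_lt {α : EpsChain δ x y} (hδ : δ < ε) {β : EpsChain ε x y}
    (h : (α.ofLE hδ.le).Homotopic β) : ∃ (δ' : ℝ) (h' : δ ≤ δ'), δ' < ε ∧
      ∃ β' : EpsChain δ' x y, β'.tail = β.tail ∧ (α.ofLE h').Homotopic β' := by
  induction h with
  | refl => exact ⟨δ, le_rfl, hδ, α, rfl, .refl _⟩
  | @tail β γ _ hmove ih =>
    obtain ⟨δ₁, hδ₁, hlt₁, β', hβ', hhom⟩ := ih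
    obtain ⟨δ₂, hδ₂, hlt₂, hγ⟩ := exists_lt_isChain γ.isChain hlt₁
    refine ⟨δ₂, hδ₁.trans hδ₂, hlt₂, ⟨γ.tail, hγ, γ.getLast_eq⟩, rfl, .tail (hhom.ofLE hδ₂) ?_⟩
    have hpts : (β'.ofLE hδ₂).points = β.points := congrArg (x :: ·) hβ'
    rw [BasicMove, hpts]
    exact hmove

/-- The `δ`-loop `α` becomes null when regarded as a `t`-loop, for some `t ≥ δ`. -/
def IsNullAt (α : EpsChain δ x x) (t : ℝ) : Prop := ∃ h : δ ≤ t, (α.ofLE h).IsNull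

theorem IsNullAt.mono {α : EpsChain δ x x} {s t : ℝ} (h : α.IsNullAt s) (hst : s ≤ t) :
    α.IsNullAt t := by
  obtain ⟨hs, hnull⟩ := h
  exact ⟨hs.trans hst, Homotopic.ofLE hnull hst⟩

theorem IsNullAt.exists_lt {α : EpsChain δ x x} {t : ℝ} (h : α.IsNullAt t) (ht : δ < t) :
    ∃ s < t, α.IsNullAt s := by
  obtain ⟨_, hnull⟩ := h
  obtain ⟨s, hs, hst, β, hβ, hhom⟩ := Homotopic.exists_lt ht hnull
  rw [eq_single_of_tail_nil β hβ] at hhom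
  exact ⟨s, hst, hs, hhom⟩

-- The infimum of the scales at which `α` is null would be a critical value if `α` were not null
-- there; otherwise it is `δ`, because nullity is an open condition from below.
theorem IsNullAt.isNull {α : EpsChain δ x x} (h : α.IsNullAt ε) (hδ : 0 < δ)
    (hε : ε ∈ lowerBounds (homotopyCriticalSpectrum X)) : α.IsNull := by
  have hδS : δ ∈ lowerBounds {t | α.IsNullAt t} := fun t ht => ht.1
  have hbdd : BddBelow {t | α.IsNullAt t} := ⟨δ, hδS⟩
  set τ := sInf {t | α.IsNullAt t}
  have hδτ : δ ≤ τ := le_csInf ⟨ε, h⟩ hδS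
  have hτ : α.IsNullAt τ := by
    by_contra hτ
    refine hτ (h.mono (hε ⟨hδ.trans_le hδτ, x, α.ofLE hδτ, fun hn => hτ ⟨hδτ, hn⟩, fun t ht => ?_⟩))
    obtain ⟨s, hs, hst⟩ := exists_lt_of_csInf_lt ⟨ε, h⟩ ht
    exact (hs.mono hst.le).2
  have hδ_eq : δ = τ := hδτ.eq_of_not_lt fun hlt => by
    obtain ⟨s, hs, hnull⟩ := hτ.exists_lt hlt
    exact hs.not_ge (csInf_le hbdd hnull)
  rw [← hδ_eq] at hτ
  exact hτ.2

theorem Homotopic.of_ofLE (hε : ε ∈ lowerBounds (homotopyCriticalSpectrum X)) (hδ : 0 < δ)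
    (h : δ ≤ ε) {α β : EpsChain δ x y} (hαβ : (α.ofLE h).Homotopic (β.ofLE h)) :
    α.Homotopic β := by
  have hnull : (α.concat β.reverse).IsNullAt ε :=
    ⟨h, (hαβ.concat_right (β.ofLE h).reverse).trans (concat_reverse _)⟩
  rw [← ChainClass.mk_eq_mk]
  exact ChainClass.eq_of_concat_reverse_eq_one (ChainClass.mk_eq_mk.2 (hnull.isNull hδ hε))

end EpsChain

section Spectrum

variable {X : Type*} [MetricSpace X] {ε δ r : ℝ} {x y z : X}

theorem mem_lowerBounds_homotopyCriticalSpectrum (hgeo : IsGeodesicSpace X)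
    (hr : LoopsNullInBalls X r) : r / 2 ∈ lowerBounds (homotopyCriticalSpectrum X) := by
  rintro ε ⟨hε, x, α, hα, hnull⟩
  by_contra! hlt
  have htrace : (PathCover.base x).trace hgeo α.tail = PathCover.base x :=
    PathCover.trace_eq_of_homotopic hgeo hr (by linarith) (hnull (r / 2) hlt)
  exact hα (ChainClass.mk_eq_mk.1
    ((chainMap_of_trace_base hgeo hε α htrace).symm.trans (chainMap_refl hε x)))

theorem IsSubdivisionChain.ofLE {c : Path x y} {α : EpsChain δ x y} (hα : IsSubdivisionChain c α)
    (h : δ ≤ ε) : IsSubdivisionChain c (α.ofLE h) := by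
  obtain ⟨n, t, h0, h1, hlt, hball, hpts⟩ := hα
  exact ⟨n, t, h0, h1, hlt, fun i hi s hs => Metric.ball_subset_ball h (hball i hi s hs), hpts⟩

theorem chainMap_injective (hgeo : IsGeodesicSpace X) (hr0 : 0 < r) (hr : LoopsNullInBalls X r)
    (hε : 0 < ε) (hmem : ε ∈ lowerBounds (homotopyCriticalSpectrum X)) (x y : X) :
    Function.Injective (chainMap hε : Path.Homotopic.Quotient x y → ChainClass ε x y) := by
  intro q q' h
  induction q using Path.Homotopic.Quotient.ind with | mk c
  induction q' using Path.Homotopic.Quotient.ind with | mk d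
  obtain ⟨δ, hδ, hδε, hδr⟩ : ∃ δ, 0 < δ ∧ δ ≤ ε ∧ 2 * δ ≤ r :=
    ⟨min ε (r / 2), by positivity, min_le_left _ _, by linarith [min_le_right ε (r / 2)]⟩
  obtain ⟨α, hα⟩ := exists_isSubdivisionChain hδ c
  obtain ⟨β, hβ⟩ := exists_isSubdivisionChain hδ d
  rw [chainMap_mk hε c _ (hα.ofLE hδε), chainMap_mk hε d _ (hβ.ofLE hδε),
    ChainClass.mk_eq_mk] at h
  rw [← PathCover.mk_eq_mk_iff, ← PathCover.trace_of_isSubdivisionChain hgeo hr (by linarith) hα,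
    ← PathCover.trace_of_isSubdivisionChain hgeo hr (by linarith) hβ]
  exact PathCover.trace_eq_of_homotopic hgeo hr hδr (EpsChain.Homotopic.of_ofLE hmem hδ hδε h)

theorem listLength_map_range (f : ℕ → X) (n : ℕ) :
    listLength ((List.range (n + 1)).map f) = ∑ i ∈ Finset.range n, dist (f i) (f (i + 1)) := by
  induction n generalizing f with
  | zero => simp [listLength]
  | succ n ih =>
    have h := ih fun i => f (i + 1)
    rw [List.range_succ_eq_map, List.map_cons, List.map_map] at h ⊢
    rw [List.range_succ_eq_map, List.map_cons, List.map_map, listLength, Finset.sum_range_succ',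
      add_comm, ← h]
    rfl

theorem sum_dist_le_pathLength (c : Path x y) {t : ℕ → I} {n : ℕ}
    (ht : ∀ i < n, t i ≤ t (i + 1)) :
    ENNReal.ofReal (∑ i ∈ Finset.range n, dist (c (t i)) (c (t (i + 1)))) ≤ pathLength c := by
  have hmono : MonotoneOn t (Set.Iic n) := by
    intro i _ j hj hij
    induction j, hij using Nat.le_induction with
    | base => exact le_rfl
    | succ j _ ih => exact (ih (Nat.le_of_succ_le hj)).trans (ht j hj)
  rw [ENNReal.ofReal_sum_of_nonneg fun _ _ => dist_nonneg]
  simp only [← edist_dist, edist_comm (c (t _)) (c (t (_ + 1)))]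
  exact eVariationOn.sum_le_of_monotoneOn_Iic hmono fun i _ => Set.mem_univ (t i)

theorem IsSubdivisionChain.length_le {c : Path x y} {α : EpsChain ε x y}
    (hα : IsSubdivisionChain c α) : ENNReal.ofReal α.length ≤ pathLength c := by
  obtain ⟨n, t, -, -, hlt, -, hpts⟩ := hα
  rw [EpsChain.length, hpts, listLength_map_range]
  exact sum_dist_le_pathLength c fun i hi => (hlt i hi).le

theorem norm_chainMap_le_pathClassNorm (hε : 0 < ε) (q : Path.Homotopic.Quotient x y) :
    ENNReal.ofReal (chainMap hε q).norm ≤ pathClassNorm q := by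
  refine le_iInf₂ fun c hc => ?_
  obtain ⟨α, hα⟩ := exists_isSubdivisionChain hε c
  rw [← hc, chainMap_mk hε c α hα]
  exact (ENNReal.ofReal_le_ofReal (ChainClass.norm_le_length α)).trans hα.length_le

theorem pathClassNorm_eq (hgeo : IsGeodesicSpace X) (hr0 : 0 < r) (hr : LoopsNullInBalls X r)
    (hε : 0 < ε) (hmem : ε ∈ lowerBounds (homotopyCriticalSpectrum X))
    (q : Path.Homotopic.Quotient x y) :
    pathClassNorm q = ENNReal.ofReal (chainMap hε q).norm := by
  refine le_antisymm (ENNReal.le_of_forall_pos_le_add fun η hη _ => ?_)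
    (norm_chainMap_le_pathClassNorm hε q)
  obtain ⟨γ, hγ, hlt⟩ := ChainClass.exists_length_lt (a := chainMap hε q)
    (lt_add_of_pos_right _ (NNReal.coe_pos.2 hη))
  obtain ⟨c, hc, hlen⟩ := PathCover.exists_trace_tail_eq_mk hgeo γ
  have hcq : Path.Homotopic.Quotient.mk c = q := chainMap_injective hgeo hr0 hr hε hmem x y
    ((chainMap_of_trace_base hgeo hε γ hc).trans hγ)
  calc pathClassNorm q ≤ pathLength c := iInf₂_le c hcq
    _ ≤ ENNReal.ofReal γ.length := hlen
    _ ≤ ENNReal.ofReal ((chainMap hε q).norm + η) := ENNReal.ofReal_le_ofReal hlt.le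
    _ ≤ ENNReal.ofReal (chainMap hε q).norm + η := ENNReal.ofReal_add_le.trans (by simp)

end Spectrum

/-! ### The universal covering -/

theorem ChainClass.eq_mk_pair_of_norm_lt {X : Type*} [MetricSpace X] {ε : ℝ} {x y : X}
    {a : ChainClass ε x y} (h : a.norm < ε) :
    ∃ h' : dist x y < ε, a = .mk (EpsChain.pair h') := by
  obtain ⟨γ, rfl, hγ⟩ := ChainClass.exists_length_lt h
  exact ⟨γ.dist_le_length.trans_lt hγ, ChainClass.mk_eq_mk.2 (γ.homotopic_pair hγ)⟩

namespace EpsCover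

variable {X : Type*} [MetricSpace X] {ε : ℝ} {p x y : X}

theorem dist_eq (a b : EpsCover ε p) : dist a b = ((a.cls.reverse).concat b.cls).norm := rfl

theorem dist_endpoint_le (a b : EpsCover ε p) : dist a.endpoint b.endpoint ≤ dist a b :=
  ChainClass.dist_le_norm _

theorem snoc_endpoint_of_dist_lt {a b : EpsCover ε p} (h : dist a b < ε) :
    a.snoc b.endpoint = b := by
  obtain ⟨h', hpair⟩ := ChainClass.eq_mk_pair_of_norm_lt h
  rw [snoc_eq h', ← hpair, ← ChainClass.concat_assoc, ChainClass.concat_reverse,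
    ChainClass.one_concat]

theorem eq_of_dist_lt (hε : 0 < ε) {a b : EpsCover ε p} (hend : a.endpoint = b.endpoint)
    (h : dist a b < ε) : a = b := by
  rw [← snoc_endpoint_of_dist_lt h, snoc_self hε hend]

theorem snoc_snoc_endpoint (hε : 0 < ε) {a : EpsCover ε p} (h : dist a.endpoint x < ε) :
    (a.snoc x).snoc a.endpoint = a := by
  rw [snoc_snoc h (by rwa [dist_comm]) (by rwa [dist_self]), snoc_self hε rfl]

theorem snoc_eq_snoc_of_dist_lt {a b : EpsCover ε p} (hab : dist a b < ε)
    (ha : dist a.endpoint x < ε) (hb : dist b.endpoint x < ε) : a.snoc x = b.snoc x := by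
  rw [← snoc_snoc ((dist_endpoint_le a b).trans_lt hab) hb ha, snoc_endpoint_of_dist_lt hab]

theorem dist_snoc_le {a : EpsCover ε p} (h : dist a.endpoint x < ε) :
    dist a (a.snoc x) ≤ dist a.endpoint x := by
  rw [snoc_eq h, dist_eq, ← ChainClass.concat_assoc, ChainClass.reverse_concat_self,
    ChainClass.one_concat]
  refine (ChainClass.norm_le_length _).trans_eq ?_
  simp [EpsChain.length, EpsChain.points, EpsChain.pair, listLength]

theorem dist_snoc_snoc_le {a : EpsCover ε p} (hx : dist a.endpoint x < ε)
    (hy : dist a.endpoint y < ε) (hxy : dist x y < ε) :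
    dist (a.snoc x) (a.snoc y) ≤ dist x y := by
  have hend : (a.snoc x).endpoint = x := snoc_fst hx
  have h := dist_snoc_le (a := a.snoc x) (x := y) (by rwa [hend])
  rwa [hend, snoc_snoc hx hxy hy] at h

theorem continuousOn_snoc (a : EpsCover ε p) :
    ContinuousOn a.snoc (Metric.ball a.endpoint ε) := by
  refine Metric.continuousOn_iff.2 fun x hx η hη => ?_
  rw [Metric.mem_ball, dist_comm] at hx
  refine ⟨min ε η, lt_min (dist_nonneg.trans_lt hx) hη, fun y hy hyx => ?_⟩
  rw [Metric.mem_ball, dist_comm] at hy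
  rw [lt_min_iff] at hyx
  exact (dist_snoc_snoc_le hy hx hyx.1).trans_lt hyx.2

theorem continuous_endpointMap : Continuous (endpointMap ε p) :=
  (LipschitzWith.mk_one dist_endpoint_le).continuous

theorem dist_endpoint_lt_of_mem_fiber {a : EpsCover ε p} (ha : a ∈ endpointMap ε p ⁻¹' {x})
    (hy : y ∈ Metric.ball x ε) : dist a.endpoint y < ε := by
  rwa [show a.endpoint = x from ha, dist_comm]

theorem discreteTopology_fiber (hε : 0 < ε) (x : X) :
    DiscreteTopology (endpointMap ε p ⁻¹' {x}) :=
  .of_forall_le_dist hε fun a b hab => by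
    by_contra! h
    exact hab (Subtype.ext (eq_of_dist_lt hε (a.2.trans b.2.symm) h))

/-- The set-theoretic trivialization of `X_ε → X` over the ball of radius `ε` around `x`: a class is
sent to the class over `x` obtained by adjoining `x` to it. -/
noncomputable def ballEquiv (hε : 0 < ε) (x : X) : endpointMap ε p ⁻¹' Metric.ball x ε ≃
    Metric.ball x ε × (endpointMap ε p ⁻¹' {x}) where
  toFun b := (⟨b.1.endpoint, b.2⟩, ⟨b.1.snoc x, snoc_fst b.2⟩)
  invFun ya := ⟨ya.2.1.snoc ya.1, by
    rw [Set.mem_preimage, endpointMap,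
      snoc_fst (dist_endpoint_lt_of_mem_fiber ya.2.2 ya.1.2)]
    exact ya.1.2⟩
  left_inv b := Subtype.ext (snoc_snoc_endpoint hε b.2)
  right_inv ya := by
    obtain ⟨⟨y, hy⟩, a, rfl⟩ := ya
    have hy' := dist_endpoint_lt_of_mem_fiber rfl hy
    exact Prod.ext (Subtype.ext (snoc_fst hy')) (Subtype.ext (snoc_snoc_endpoint hε hy'))

theorem continuous_ballEquiv (hε : 0 < ε) (x : X) :
    Continuous (ballEquiv (p := p) hε x) := by
  refine ((continuous_endpointMap.comp continuous_subtype_val).subtype_mk _).prodMk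
    (IsLocallyConstant.continuous ((IsLocallyConstant.iff_eventually_eq _).2 fun b => ?_))
  filter_upwards [Metric.ball_mem_nhds b hε] with b' hb'
  exact Subtype.ext (snoc_eq_snoc_of_dist_lt hb' b'.2 b.2)

theorem continuous_ballEquiv_symm (hε : 0 < ε) (x : X) :
    Continuous (ballEquiv (p := p) hε x).symm := by
  have := discreteTopology_fiber (p := p) hε x
  refine continuous_prod_of_discrete_right.2 fun a => Continuous.subtype_mk ?_ _
  exact (continuousOn_snoc a.1).comp_continuous continuous_subtype_val fun y => by
    rw [Metric.mem_ball, dist_comm]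
    exact dist_endpoint_lt_of_mem_fiber a.2 y.2

theorem isCoveringMap_endpointMap (hε : 0 < ε) : IsCoveringMap (endpointMap ε p) := fun x =>
  ⟨discreteTopology_fiber hε x, Metric.ball x ε, Metric.mem_ball_self hε, Metric.isOpen_ball,
    Metric.isOpen_ball.preimage continuous_endpointMap,
    ⟨ballEquiv hε x, continuous_ballEquiv hε x, continuous_ballEquiv_symm hε x⟩, fun _ => rfl⟩

theorem joined_snoc (hgeo : IsGeodesicSpace X) (hε : 0 < ε) {a : EpsCover ε p}
    (h : dist a.endpoint x < ε) : Joined a (a.snoc x) := by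
  refine ⟨⟨⟨fun t => a.snoc (hgeo.path a.endpoint x t), ?_⟩, ?_, ?_⟩⟩
  · refine (continuousOn_snoc a).comp_continuous (hgeo.path a.endpoint x).continuous fun t => ?_
    rw [Metric.mem_ball, dist_comm]
    exact (hgeo.dist_source_path a.endpoint x t).trans_lt h
  · simp only [Path.source, snoc_self hε rfl]
  · simp only [Path.target]

theorem joined_mk_concat (hgeo : IsGeodesicSpace X) (hε : 0 < ε) (a : ChainClass ε p x)
    (γ : EpsChain ε x y) : Joined (⟨x, a⟩ : EpsCover ε p) ⟨y, a.concat (.mk γ)⟩ := by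
  generalize hl : γ.tail = l
  induction l generalizing x with
  | nil =>
    obtain rfl : x = y := by simpa only [hl, List.getLast_singleton] using γ.getLast_eq
    rw [EpsChain.eq_single_of_tail_nil γ hl, ← ChainClass.one, ChainClass.concat_one]
  | cons b l ih =>
    obtain ⟨hb, β, hβ, rfl⟩ := EpsChain.eq_pair_concat γ hl
    have hsnoc := joined_snoc hgeo hε (a := ⟨x, a⟩) hb
    rw [snoc_eq hb] at hsnoc
    rw [← ChainClass.concat_mk, ← ChainClass.concat_assoc]
    exact hsnoc.trans (ih _ β hβ)

theorem pathConnectedSpace (hgeo : IsGeodesicSpace X) (hε : 0 < ε) :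
    PathConnectedSpace (EpsCover ε p) := by
  refine pathConnectedSpace_iff_univ.2 ⟨⟨p, .one ε p⟩, Set.mem_univ _, ?_⟩
  rintro ⟨y, b⟩ -
  obtain ⟨γ, rfl⟩ := ChainClass.mk_surjective b
  have h := joined_mk_concat hgeo hε (.one ε p) γ
  rw [ChainClass.one_concat] at h
  exact joinedIn_univ.2 h

-- The class `γ t` itself records the chain traced by the projected path up to time `t`, so paths
-- in `X_ε` are lifts of their images under `Λ`.
theorem chainMap_map_endpointMap (hε : 0 < ε) {a b : EpsCover ε p} (γ : Path a b) :
    chainMap hε (.mk (γ.map continuous_endpointMap : Path a.endpoint b.endpoint)) =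
      a.cls.reverse.concat b.cls := by
  obtain ⟨M, hM, hfine⟩ := exists_fine_modulus hε γ γ.continuous
  have hlift (i : ℕ) (hi : i ≤ M) : translate a.cls
      (ofSeq ε a.endpoint (fun i => (γ (unitFrac M i)).endpoint) i) = γ (unitFrac M i) := by
    induction i with
    | zero =>
      rw [unitFrac_zero hM, γ.source, ofSeq, translate, ChainClass.concat_one]
    | succ i ih =>
      rw [ofSeq, ← translate_snoc, ih (by omega)]
      refine snoc_endpoint_of_dist_lt (hfine _ _ ?_)
      rw [Subtype.dist_eq, Real.dist_eq, coe_unitFrac_succ hM hi, sub_add_cancel_left, abs_neg,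
        abs_of_nonneg (by positivity)]
  have hchain := chainMap_eq_ofSeq hε (γ.map continuous_endpointMap) hM fun s t hst =>
    (dist_endpoint_le (γ s) (γ t)).trans_lt (hfine s t hst)
  have hb := hlift M le_rfl
  rw [unitFrac_self hM, γ.target] at hb
  have hcls : a.cls.concat (chainMap hε (.mk (γ.map continuous_endpointMap))) = b.cls :=
    mk_eq_mk_iff.1 ((congrArg (translate a.cls) hchain).trans hb)
  rw [← hcls, ← ChainClass.concat_assoc, ChainClass.reverse_concat_self, ChainClass.one_concat]

end EpsCover

section UniversalCovering

variable {X : Type*} [MetricSpace X] {ε r : ℝ} (hgeo : IsGeodesicSpace X) (hr0 : 0 < r)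
  (hr : LoopsNullInBalls X r) (hε : 0 < ε) (hmem : ε ∈ lowerBounds (homotopyCriticalSpectrum X))
include hgeo hr0 hr hε hmem

theorem isUniversalCoveringMap_endpointMap (p : X) :
    IsUniversalCoveringMap (endpointMap ε p) := by
  have hcov := EpsCover.isCoveringMap_endpointMap (p := p) hε
  refine ⟨hcov, fun y => ⟨⟨y, chainMap hε (.mk (hgeo.path p y))⟩, rfl⟩, ?_⟩
  refine simply_connected_iff_paths_homotopic'.2
    ⟨EpsCover.pathConnectedSpace hgeo hε, fun {a b} γ γ' => ?_⟩
  have hproj := chainMap_injective hgeo hr0 hr hε hmem _ _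
    ((EpsCover.chainMap_map_endpointMap hε γ).trans (EpsCover.chainMap_map_endpointMap hε γ').symm)
  exact Path.Homotopic.Quotient.eq.1 (hcov.injective_path_homotopic_map a b hproj)

theorem exists_mulEquiv_chainMap (p : X) :
    ∃ Φ : (FundamentalGroup X p)ᵐᵒᵖ ≃* EpsGroup ε p,
      ∀ g : FundamentalGroup X p, Φ (MulOpposite.op g) = chainMap hε g.toPath := by
  have hbij : Function.Bijective fun g : (FundamentalGroup X p)ᵐᵒᵖ =>
      (chainMap hε g.unop.toPath : EpsGroup ε p) := by
    refine ⟨fun g h hgh => MulOpposite.unop_injective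
      (chainMap_injective hgeo hr0 hr hε hmem p p hgh), fun a => ?_⟩
    obtain ⟨q, hq⟩ := chainMap_surjective hgeo hε p p a
    exact ⟨MulOpposite.op (FundamentalGroup.fromPath q), hq⟩
  exact ⟨⟨Equiv.ofBijective _ hbij, fun g h => chainMap_trans hε _ _⟩, fun g => rfl⟩

end UniversalCovering

/-! ### Free homotopies -/

section Free

variable {X : Type*} [TopologicalSpace X] {x y z : X}

theorem freelyHomotopic_iff_homotopicWith {c : Path x x} {c' : Path y y} :
    FreelyHomotopic c c' ↔ ContinuousMap.HomotopicWith c.toContinuousMap c'.toContinuousMap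
      fun f => f 0 = f 1 :=
  ⟨fun ⟨H, h0, h1, h⟩ => ⟨⟨⟨H, h0, h1⟩, h⟩⟩,
    fun ⟨H⟩ => ⟨H.toContinuousMap, H.map_zero_left, H.map_one_left, H.prop'⟩⟩

theorem FreelyHomotopic.symm {c : Path x x} {c' : Path y y} (h : FreelyHomotopic c c') :
    FreelyHomotopic c' c := by
  rw [freelyHomotopic_iff_homotopicWith] at h ⊢
  exact h.symm

theorem FreelyHomotopic.trans {c : Path x x} {c' : Path y y} {c'' : Path z z}
    (h : FreelyHomotopic c c') (h' : FreelyHomotopic c' c'') : FreelyHomotopic c c'' := by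
  rw [freelyHomotopic_iff_homotopicWith] at h h' ⊢
  exact h.trans h'

theorem freelyHomotopic_of_homotopic {c c' : Path x x} (h : c.Homotopic c') :
    FreelyHomotopic c c' := by
  obtain ⟨H⟩ := h
  exact ⟨H.toContinuousMap, H.map_zero_left, H.map_one_left,
    fun s => (H.source s).trans (H.target s).symm⟩

theorem freelyHomotopic_conj (c : Path x x) (p : Path x y) :
    FreelyHomotopic c ((p.symm.trans c).trans p) := by
  let P (s : I) : Path x (p s) := (p.subpath 0 s).cast p.source.symm rfl
  have hP : Continuous fun st : I × I => P st.1 st.2 :=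
    p.subpath_continuous_family.comp (by fun_prop : Continuous fun st : I × I => ((0 : I), st))
  have hconj : Continuous fun st : I × I => (((P st.1).symm.trans c).trans (P st.1)) st.2 :=
    Path.trans_continuous_family _ (Path.trans_continuous_family _
      (Path.symm_continuous_family P hP) (fun _ => c) (c.continuous.comp continuous_snd)) P hP
  have hrefl : FreelyHomotopic c (((Path.refl x).symm.trans c).trans (Path.refl x)) := by
    refine freelyHomotopic_of_homotopic (Path.Homotopic.Quotient.eq.1 ?_)
    simp
  refine hrefl.trans ⟨⟨_, hconj⟩, fun t => ?_, fun t => ?_, fun s => by simp⟩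
  all_goals simp [P, Path.trans_apply]

theorem freelyHomotopic_of_trans_eq {c : Path x x} {c' : Path y y} {p : Path x y}
    (h : (Path.Homotopic.Quotient.mk c).trans (.mk p) =
      (Path.Homotopic.Quotient.mk p).trans (.mk c')) : FreelyHomotopic c c' := by
  refine (freelyHomotopic_conj c p).trans
    (freelyHomotopic_of_homotopic (Path.Homotopic.Quotient.eq.1 ?_))
  simp only [Path.Homotopic.Quotient.mk_trans, Path.Homotopic.Quotient.mk_symm,
    Path.Homotopic.Quotient.trans_assoc, h]
  rw [← Path.Homotopic.Quotient.trans_assoc, Path.Homotopic.Quotient.symm_trans,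
    Path.Homotopic.Quotient.refl_trans]

end Free

/-! ### Existence of shortest paths and loops -/

theorem exists_forall_ofReal_le {Y ι : Type*} [TopologicalSpace Y] [CompactSpace Y] {K : Set Y}
    (hK : IsClosed K) {F : Y → ℝ} (hF : Continuous F) {L : ι → ℝ≥0∞} {b : ℝ≥0∞}
    (hb : ∃ i, L i < b) (h : ∀ i, L i < b → ∃ f ∈ K, ENNReal.ofReal (F f) ≤ L i) :
    ∃ f ∈ K, ∀ i, ENNReal.ofReal (F f) ≤ L i := by
  obtain ⟨i₀, hi₀⟩ := hb
  obtain ⟨f₀, hf₀, hle₀⟩ := h i₀ hi₀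
  obtain ⟨f, hf, hmin⟩ := hK.isCompact.exists_isMinOn ⟨f₀, hf₀⟩ hF.continuousOn
  refine ⟨f, hf, fun i => ?_⟩
  rcases lt_or_ge (L i) b with hlt | hge
  · obtain ⟨g, hg, hle⟩ := h i hlt
    exact (ENNReal.ofReal_le_ofReal (hmin hg)).trans hle
  · calc ENNReal.ofReal (F f) ≤ ENNReal.ofReal (F f₀) := ENNReal.ofReal_le_ofReal (hmin hf₀)
      _ ≤ L i₀ := hle₀
      _ ≤ L i := hi₀.le.trans hge

section Polygon

variable {X : Type*} [MetricSpace X] {δ r : ℝ} {x y : X}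

theorem exists_next_time (c : Path x y) (hδ : 0 ≤ δ) (u : I) : ∃ v : I, u ≤ v ∧
    (∀ s ∈ Set.Icc u v, dist (c u) (c s) ≤ δ) ∧ (v = 1 ∨ δ ≤ dist (c u) (c v)) := by
  have hdist : Continuous fun s => dist (c u) (c s) := continuous_const.dist c.continuous
  have hclosed : IsClosed {s : I | u ≤ s ∧ (s = 1 ∨ δ ≤ dist (c u) (c s))} :=
    isClosed_Ici.inter (isClosed_singleton.union (isClosed_le continuous_const hdist))
  obtain ⟨v, ⟨huv, hv⟩, hmin⟩ := hclosed.isCompact.exists_isLeast ⟨1, u.2.2, Or.inl rfl⟩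
  refine ⟨v, huv, ?_, hv⟩
  rcases huv.eq_or_lt with rfl | hlt
  · rintro s hs
    rwa [le_antisymm hs.2 hs.1, dist_self]
  · have hIco : Set.Ico u v ⊆ {s : I | dist (c u) (c s) ≤ δ} := fun s hs => by
      by_contra hcon
      exact hs.2.not_ge (hmin ⟨hs.1, Or.inr (not_le.1 hcon).le⟩)
    have hIcc := closure_minimal hIco (isClosed_le hdist continuous_const)
    rwa [closure_Ico hlt.ne] at hIcc

theorem exists_subdivision (c : Path x y) (hδ : 0 ≤ δ) {N : ℕ}
    (hN : pathLength c < ENNReal.ofReal (N * δ)) :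
    ∃ t : ℕ → I, t 0 = 0 ∧ t N = 1 ∧ Monotone t ∧
      ∀ i, ∀ s ∈ Set.Icc (t i) (t (i + 1)), dist (c (t i)) (c s) ≤ δ := by
  choose next hle hball hnext using exists_next_time c hδ
  let t (i : ℕ) : I := next^[i] 0
  have ht (i : ℕ) : t (i + 1) = next (t i) := Function.iterate_succ_apply' next i 0
  have hmono : Monotone t := monotone_nat_of_le_succ fun i => (hle (t i)).trans_eq (ht i).symm
  refine ⟨t, rfl, ?_, hmono, fun i s hs => hball _ s (by rwa [ht] at hs)⟩
  by_contra htN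
  have hstep : ∀ i ∈ Finset.range N, δ ≤ dist (c (t i)) (c (t (i + 1))) := fun i hi => by
    rw [ht]
    refine (hnext (t i)).resolve_left fun h1 => htN (le_antisymm (t N).2.2 ?_)
    rw [← h1, ← ht]
    exact hmono (Finset.mem_range.1 hi)
  have hsum : (N : ℝ) * δ ≤ ∑ i ∈ Finset.range N, dist (c (t i)) (c (t (i + 1))) := by
    simpa using Finset.card_nsmul_le_sum _ _ δ hstep
  exact hN.not_ge ((ENNReal.ofReal_le_ofReal hsum).trans
    (sum_dist_le_pathLength c fun i _ => hmono i.le_succ))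

/-- The length of the polygon with vertices `f 0, …, f N`. -/
noncomputable def polygonLength (f : ℕ → X) (N : ℕ) : ℝ :=
  ∑ i ∈ Finset.range N, dist (f i) (f (i + 1))

theorem continuous_polygonLength (N : ℕ) : Continuous fun f : ℕ → X => polygonLength f N :=
  continuous_finsetSum _ fun i _ => (continuous_apply i).dist (continuous_apply (i + 1))

theorem exists_nat_pathLength_lt (hδ : 0 < δ) {c : Path x y} (hc : pathLength c ≠ ⊤) :
    ∃ N : ℕ, pathLength c < ENNReal.ofReal (N * δ) := by
  obtain ⟨N, hN⟩ := exists_nat_gt ((pathLength c).toReal / δ)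
  exact ⟨N, (ENNReal.lt_ofReal_iff_toReal_lt hc).2 ((div_lt_iff₀ hδ).1 hN)⟩

theorem isClosed_setOf_steps_le (N : ℕ) (δ : ℝ) :
    IsClosed {f : ℕ → X | ∀ i < N, dist (f i) (f (i + 1)) ≤ δ} := by
  simp only [Set.ofPred_forall]
  exact isClosed_iInter fun i => isClosed_iInter fun _ =>
    isClosed_le ((continuous_apply i).dist (continuous_apply (i + 1))) continuous_const

theorem isClosed_sep_of_forall_dist_lt {K : Set (ℕ → X)} (hK : IsClosed K) {P : (ℕ → X) → Prop}
    (N : ℕ) {η : ℝ} (hη : 0 < η)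
    (h : ∀ f ∈ K, ∀ g ∈ K, (∀ i ≤ N, dist (f i) (g i) < η) → P g → P f) :
    IsClosed {f | f ∈ K ∧ P f} := by
  refine isClosed_of_closure_subset fun f hf => ?_
  have hfK : f ∈ K := closure_minimal (fun _ hg => hg.1) hK hf
  have hopen : IsOpen {g : ℕ → X | ∀ i ∈ Finset.range (N + 1), dist (f i) (g i) < η} := by
    simp only [Set.ofPred_forall]
    exact isOpen_biInter_finset fun i _ =>
      isOpen_lt (continuous_const.dist (continuous_apply i)) continuous_const
  obtain ⟨g, hfg, hg⟩ := mem_closure_iff.1 hf _ hopen fun i _ => by simpa using hη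
  exact ⟨hfK, h f hfK g hg.1 (fun i hi => hfg i (Finset.mem_range.2 (by omega))) hg.2⟩

variable (hgeo : IsGeodesicSpace X)
include hgeo

theorem exists_polygon (hr : LoopsNullInBalls X r) (hδ : 0 ≤ δ) (hδr : δ < r) (c : Path x y)
    {N : ℕ} (hN : pathLength c < ENNReal.ofReal (N * δ)) :
    ∃ f : ℕ → X, f 0 = x ∧ f N = y ∧ (∀ i < N, dist (f i) (f (i + 1)) ≤ δ) ∧
      (PathCover.base x).walk hgeo f N = ⟨y, .mk c⟩ ∧
      ENNReal.ofReal (polygonLength f N) ≤ pathLength c := by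
  obtain ⟨t, ht0, htN, hmono, hball⟩ := exists_subdivision c hδ hN
  have hle (i : ℕ) : t i ≤ t (i + 1) := hmono i.le_succ
  exact ⟨fun i => c (t i), by simp [ht0], by simp [htN], fun i _ => hball i _ ⟨hle i, le_rfl⟩,
    PathCover.walk_eq_mk hgeo hr c ht0 htN (fun i _ => hle i)
      fun i _ s hs => (hball i s hs).trans_lt hδr, sum_dist_le_pathLength c fun i _ => hle i⟩

theorem exists_path_walk {f : ℕ → X} {N : ℕ} {q : Path.Homotopic.Quotient (f 0) y}
    (h : (PathCover.base (f 0)).walk hgeo f N = ⟨y, q⟩) :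
    ∃ c : Path (f 0) y, .mk c = q ∧ pathLength c ≤ ENNReal.ofReal (polygonLength f N) := by
  have hvertices : f 0 :: (List.range N).map (fun i => f (i + 1)) = (List.range (N + 1)).map f := by
    rw [List.range_succ_eq_map, List.map_cons, List.map_map]
    rfl
  rw [polygonLength, ← listLength_map_range, ← hvertices]
  exact PathCover.exists_path_trace_base hgeo h

theorem exists_homotopic_pathLength_ne_top (hr0 : 0 < r) (hr : LoopsNullInBalls X r)
    (c : Path x y) : ∃ c' : Path x y, c.Homotopic c' ∧ pathLength c' ≠ ⊤ := by
  obtain ⟨α, hα⟩ := exists_isSubdivisionChain hr0 c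
  obtain ⟨c', hc', hlen⟩ := PathCover.exists_trace_tail_eq_mk hgeo α
  rw [PathCover.trace_of_isSubdivisionChain hgeo hr le_rfl hα, PathCover.mk_eq_mk_iff,
    Path.Homotopic.Quotient.eq] at hc'
  exact ⟨c', hc', (hlen.trans_lt ENNReal.ofReal_lt_top).ne⟩

end Polygon

section Existence

variable {X : Type*} [MetricSpace X] {δ r : ℝ} {x y : X}

/-- The vertex sequences of the polygons with `N` sides of length at most `δ` which are homotopic
to `c` with fixed endpoints. -/
def polygonsInClass (hgeo : IsGeodesicSpace X) (δ : ℝ) (N : ℕ) (c : Path x y) : Set (ℕ → X) :=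
  {f | f ∈ {f | f 0 = x} ∩ {f | f N = y} ∩ {f | ∀ i < N, dist (f i) (f (i + 1)) ≤ δ} ∧
    (PathCover.base x).walk hgeo f N = ⟨y, .mk c⟩}

/-- The vertex sequences of the closed polygons with `N` sides of length at most `δ` which are
freely homotopic to `c`. -/
def polygonsInFreeClass (hgeo : IsGeodesicSpace X) (δ : ℝ) (N : ℕ) (c : Path x x) :
    Set (ℕ → X) :=
  {f | f ∈ {f | f N = f 0} ∩ {f | ∀ i < N, dist (f i) (f (i + 1)) ≤ δ} ∧
    ∃ d : Path (f 0) (f 0), (PathCover.base (f 0)).walk hgeo f N = ⟨f 0, .mk d⟩ ∧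
      FreelyHomotopic c d}

variable (hgeo : IsGeodesicSpace X) (hr0 : 0 < r) (hr : LoopsNullInBalls X r)
include hr0 hr

theorem isClosed_polygonsInClass (hδr : 2 * δ < r) (N : ℕ) (c : Path x y) :
    IsClosed (polygonsInClass hgeo δ N c) := by
  refine isClosed_sep_of_forall_dist_lt
    (((isClosed_singleton.preimage (continuous_apply 0)).inter
      (isClosed_singleton.preimage (continuous_apply N))).inter (isClosed_setOf_steps_le N δ))
    N (half_pos hr0) ?_
  rintro f ⟨⟨hf0, hfN⟩, hf⟩ g ⟨⟨hg0, hgN⟩, hg⟩ hfg hwalk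
  have hmove := PathCover.walk_snoc_eq hgeo hr (η := r / 2) (by linarith)
    (a := PathCover.base x) (Eq.symm hf0) hfg (fun i hi => (hf i hi).trans_lt (by linarith))
    fun i hi => (hg i hi).trans_lt (by linarith)
  rwa [show g N = y from hgN, show g 0 = x from hg0,
    PathCover.snoc_self hgeo (a := PathCover.base x) (z := x) rfl, hwalk,
    PathCover.snoc_self] at hmove
  exact (PathCover.endpoint_walk hgeo (a := PathCover.base x) (Eq.symm hf0) N).trans hfN

theorem isClosed_polygonsInFreeClass (hδr : 2 * δ < r) (N : ℕ) (c : Path x x) :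
    IsClosed (polygonsInFreeClass hgeo δ N c) := by
  refine isClosed_sep_of_forall_dist_lt
    ((isClosed_eq (continuous_apply N) (continuous_apply 0)).inter (isClosed_setOf_steps_le N δ))
    N (half_pos hr0) ?_
  rintro f ⟨hfN, hf⟩ g ⟨hgN, hg⟩ hfg ⟨d, hwalk, hd⟩
  have hmove := PathCover.walk_snoc_eq hgeo hr (η := r / 2) (by linarith)
    (a := PathCover.base (f 0)) rfl hfg (fun i hi => (hf i hi).trans_lt (by linarith))
    fun i hi => (hg i hi).trans_lt (by linarith)
  obtain ⟨q, hq⟩ := PathCover.exists_eq_of_endpoint_eq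
    ((PathCover.endpoint_walk hgeo (a := PathCover.base (f 0)) rfl N).trans hfN)
  obtain ⟨e, rfl⟩ := Path.Homotopic.Quotient.mk_surjective q
  refine ⟨e, hq, hd.trans (FreelyHomotopic.symm ?_)⟩
  have hsnoc : (PathCover.base (f 0)).snoc hgeo (g 0) = ⟨g 0, .mk (hgeo.path (f 0) (g 0))⟩ :=
    PathCover.mk_eq_mk_iff.2 (Path.Homotopic.Quotient.refl_trans _)
  rw [show g N = g 0 from hgN, hq, hsnoc, PathCover.walk_eq_translate, hwalk] at hmove
  exact freelyHomotopic_of_trans_eq (PathCover.mk_eq_mk_iff.1 hmove)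

variable [CompactSpace X]
include hgeo

theorem exists_isShortestInClass (c : Path x y) : ∃ c' : Path x y, IsShortestInClass c c' := by
  obtain ⟨c₀, hc₀, hfin⟩ := exists_homotopic_pathLength_ne_top hgeo hr0 hr c
  obtain ⟨N, hN⟩ := exists_nat_pathLength_lt (by positivity : 0 < r / 4) hfin
  obtain ⟨f, ⟨⟨⟨rfl, -⟩, -⟩, hwalk⟩, hmin⟩ := exists_forall_ofReal_le
    (isClosed_polygonsInClass hgeo hr0 hr (δ := r / 4) (by linarith) N c)
    (continuous_polygonLength N)
    (ι := {d : Path x y // c.Homotopic d}) (L := fun d => pathLength d.1) ⟨⟨c₀, hc₀⟩, hN⟩ <| by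
      rintro ⟨d, hd⟩ hlt
      obtain ⟨f, hf0, hfN, hf, hwalk, hle⟩ :=
        exists_polygon hgeo hr (by linarith) (by linarith) d hlt
      rw [← Path.Homotopic.Quotient.eq.2 hd] at hwalk
      exact ⟨f, ⟨⟨⟨hf0, hfN⟩, hf⟩, hwalk⟩, hle⟩
  obtain ⟨c', hc', hlen⟩ := exists_path_walk hgeo hwalk
  exact ⟨c', Path.Homotopic.Quotient.eq.1 hc'.symm, fun d hd => hlen.trans (hmin ⟨d, hd⟩)⟩

theorem exists_isShortestInFreeClass (c : Path x x) :
    ∃ (y : X) (c' : Path y y), IsShortestInFreeClass c c' := by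
  obtain ⟨c₀, hc₀, hfin⟩ := exists_homotopic_pathLength_ne_top hgeo hr0 hr c
  obtain ⟨N, hN⟩ := exists_nat_pathLength_lt (by positivity : 0 < r / 4) hfin
  obtain ⟨f, ⟨-, d, hwalk, hd⟩, hmin⟩ := exists_forall_ofReal_le
    (isClosed_polygonsInFreeClass hgeo hr0 hr (δ := r / 4) (by linarith) N c)
    (continuous_polygonLength N)
    (ι := {d : (z : X) × Path z z // FreelyHomotopic c d.2}) (L := fun d => pathLength d.1.2)
    ⟨⟨⟨x, c₀⟩, freelyHomotopic_of_homotopic hc₀⟩, hN⟩ <| by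
      rintro ⟨⟨z, d⟩, hd⟩ hlt
      obtain ⟨f, rfl, hfN, hf, hwalk, hle⟩ :=
        exists_polygon hgeo hr (by linarith) (by linarith) d hlt
      exact ⟨f, ⟨⟨hfN, hf⟩, d, hwalk, hd⟩, hle⟩
  obtain ⟨c', hc', hlen⟩ := exists_path_walk hgeo hwalk
  have hdc' := freelyHomotopic_of_homotopic (Path.Homotopic.Quotient.eq.1 hc'.symm)
  exact ⟨f 0, c', hd.trans hdc', fun z d hd => hlen.trans (hmin ⟨⟨z, d⟩, hd⟩)⟩

end Existence

/-! ### Parametrization with constant speed -/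

section ConstantSpeed

variable {X : Type*} [MetricSpace X] {x y : X} {ℓ : ℝ≥0}

/-- `g` runs with constant speed `ℓ`: the analogue of Mathlib's `HasConstantSpeedOnWith` for curves
parametrized by the unit interval. -/
def HasConstantSpeed (g : I → X) (ℓ : ℝ≥0) : Prop :=
  ∀ s t : I, s ≤ t → eVariationOn g (Set.Icc s t) = ℓ * edist s t

theorem HasConstantSpeed.lipschitzWith {g : I → X} (hg : HasConstantSpeed g ℓ) :
    LipschitzWith ℓ g := by
  intro s t
  rcases le_total s t with hst | hts
  · exact (edist_le_eVariationOn g hst).trans_eq (hg s t hst)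
  · rw [edist_comm, edist_comm s]
    exact (edist_le_eVariationOn g hts).trans_eq (hg t s hts)

theorem HasConstantSpeed.pathLength_eq {g : Path x y} (hg : HasConstantSpeed g ℓ) :
    pathLength g = ℓ := by
  rw [DiscreteHomotopy.pathLength_eq, hg 0 1 zero_le_one]
  simp [edist_dist, Subtype.dist_eq]

theorem continuous_variationOnFromTo {α : Type*} [LinearOrder α] [TopologicalSpace α]
    [OrderTopology α] {f : α → X} (hf : BoundedVariationOn f Set.univ) (hc : Continuous f) (a : α) :
    Continuous (variationOnFromTo f Set.univ a) := by
  refine continuous_iff_continuousAt.2 fun b => continuousAt_iff_continuous_left'_right'.2 ⟨?_, ?_⟩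
  · simpa [ContinuousWithinAt] using variationOnFromTo.tendsto_left (Set.mem_univ a)
      (Set.mem_univ b) hf.locallyBoundedVariationOn hc.continuousWithinAt.tendsto
  · simpa [ContinuousWithinAt] using variationOnFromTo.tendsto_right (Set.mem_univ a)
      (Set.mem_univ b) hf.locallyBoundedVariationOn hc.continuousWithinAt.tendsto

theorem exists_monotone_naturalParameterization_eq (c : Path x y) (hc : pathLength c = ℓ)
    (hℓ : 0 < ℓ) : ∃ φ : I → I, Continuous φ ∧ Monotone φ ∧ φ 0 = 0 ∧ φ 1 = 1 ∧
      (∀ t, c t = naturalParameterization c Set.univ 0 (ℓ * φ t)) ∧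
      ∀ t, ℓ * (φ t : ℝ) = variationOnFromTo c Set.univ 0 t := by
  have hbdd : BoundedVariationOn c Set.univ :=
    show pathLength c ≠ ⊤ from hc ▸ ENNReal.coe_ne_top
  have hmono : Monotone (variationOnFromTo c Set.univ 0) := monotoneOn_univ.1
    (variationOnFromTo.monotoneOn hbdd.locallyBoundedVariationOn (Set.mem_univ 0))
  have h0 : variationOnFromTo c Set.univ 0 0 = 0 := variationOnFromTo.self _ _ _
  have h1 : variationOnFromTo c Set.univ 0 1 = ℓ := by
    rw [variationOnFromTo.eq_of_le _ _ zero_le_one, Set.univ_inter, ← pathLength_eq, hc,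
      ENNReal.coe_toReal]
  have hℓ' : (0 : ℝ) < ℓ := hℓ
  let φ (t : I) : I := ⟨variationOnFromTo c Set.univ 0 t / ℓ,
    div_nonneg (h0.symm.trans_le (hmono t.2.1)) hℓ'.le,
    (div_le_one hℓ').2 ((hmono t.2.2).trans_eq h1)⟩
  have hφ (t : I) : ℓ * (φ t : ℝ) = variationOnFromTo c Set.univ 0 t :=
    mul_div_cancel₀ _ hℓ'.ne'
  refine ⟨φ, ((continuous_variationOnFromTo hbdd c.continuous 0).div_const _).subtype_mk _,
    fun s t hst => div_le_div_of_nonneg_right (hmono hst) hℓ'.le, ?_, ?_, fun t => ?_, hφ⟩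
  · ext
    simp [φ, h0]
  · ext
    simp [φ, h1, hℓ'.ne']
  · rw [hφ, ← edist_eq_zero, edist_comm]
    exact edist_naturalParameterization_eq_zero hbdd.locallyBoundedVariationOn
      (Set.mem_univ 0) (Set.mem_univ t)

theorem hasConstantSpeed_of_comp {c : I → X} (hbdd : BoundedVariationOn c Set.univ) {g : I → X}
    {φ : I → I} (hφ : Continuous φ) (hmono : Monotone φ) (h0 : φ 0 = 0) (h1 : φ 1 = 1)
    (hcg : ∀ t, c t = g (φ t)) (hv : ∀ t, ℓ * (φ t : ℝ) = variationOnFromTo c Set.univ 0 t) :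
    HasConstantSpeed g ℓ := by
  have hsurj : Function.Surjective φ := Set.range_eq_univ.1 <| by
    rw [range_eq_Icc_of_monotone hmono hφ, h0, h1]
    exact Set.Icc_bot_top
  intro u w huw
  obtain ⟨s, rfl⟩ := hsurj u
  obtain ⟨t, rfl⟩ := hsurj w
  rcases le_total s t with hst | hts
  · have himage : φ '' Set.Icc s t = Set.Icc (φ s) (φ t) :=
      (hmono.monotoneOn _).mapsTo_Icc.image_subset.antisymm
        (intermediate_value_Icc hst hφ.continuousOn)
    have hvar : variationOnFromTo c Set.univ s t = ℓ * dist (φ s) (φ t) := by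
      rw [← variationOnFromTo.sub_right hbdd.locallyBoundedVariationOn (Set.mem_univ 0)
        (Set.mem_univ t) (Set.mem_univ s), ← hv, ← hv, ← mul_sub, dist_eq_sub_of_le huw]
    calc eVariationOn g (Set.Icc (φ s) (φ t)) = eVariationOn (g ∘ φ) (Set.Icc s t) := by
          rw [← himage, eVariationOn.comp_eq_of_monotoneOn g φ (hmono.monotoneOn _)]
      _ = eVariationOn c (Set.Icc s t) := congrArg (eVariationOn · _) (funext hcg).symm
      _ = ENNReal.ofReal (variationOnFromTo c Set.univ s t) := by
          rw [variationOnFromTo.eq_of_le _ _ hst, Set.univ_inter,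
            ENNReal.ofReal_toReal (hbdd.mono (Set.subset_univ _))]
      _ = ℓ * edist (φ s) (φ t) := by
          rw [hvar, ENNReal.ofReal_mul ℓ.coe_nonneg, edist_dist, ENNReal.ofReal_coe_nnreal]
  · rw [le_antisymm huw (hmono hts), Set.Icc_self, edist_self, mul_zero]
    exact eVariationOn.subsingleton g Set.subsingleton_singleton

theorem exists_isReparametrization_hasConstantSpeed (c : Path x y) (hc : pathLength c = ℓ)
    (hℓ : 0 < ℓ) : ∃ g : Path x y, IsReparametrization c g ∧ HasConstantSpeed g ℓ := by
  obtain ⟨φ, hφ, hmono, h0, h1, hcφ, hv⟩ := exists_monotone_naturalParameterization_eq c hc hℓ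
  have hbdd : BoundedVariationOn c Set.univ :=
    show pathLength c ≠ ⊤ from hc ▸ ENNReal.coe_ne_top
  have hspeed := hasConstantSpeed_of_comp
    (g := fun u => naturalParameterization c Set.univ 0 (ℓ * u)) hbdd hφ hmono h0 h1 hcφ hv
  exact ⟨⟨⟨_, hspeed.lipschitzWith.continuous⟩, by simpa [h0] using (hcφ 0).symm,
    by simpa [h1] using (hcφ 1).symm⟩, ⟨φ, hφ, hmono, h0, h1, hcφ⟩, hspeed⟩

end ConstantSpeed

/-! ### Shortest paths -/

section ShortestPath

theorem homotopic_of_subpath_homotopic {X : Type*} [TopologicalSpace X] {x y : X} (c : Path x y)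
    {s t : I} {d : Path (c s) (c t)} (h : (c.subpath s t).Homotopic d) :
    c.Homotopic
      ((((c.subpath 0 s).trans d).trans (c.subpath t 1)).cast c.source.symm c.target.symm) := by
  have hsplit : (((c.subpath 0 s).trans (c.subpath s t)).trans (c.subpath t 1)).Homotopic
      (c.subpath 0 1) :=
    (Path.Homotopic.hcomp ⟨Path.Homotopy.subpathTransSubpath c 0 s t⟩ (.refl _)).trans
      ⟨Path.Homotopy.subpathTransSubpath c 0 t 1⟩
  have hreplace := hsplit.symm.trans (((Path.Homotopic.refl _).hcomp h).hcomp (.refl _))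
  rw [Path.subpath_zero_one] at hreplace
  exact hreplace.pathCast c.source.symm c.target.symm

variable {X : Type*} [MetricSpace X] {r : ℝ} {ℓ : ℝ≥0} {x y : X}

theorem IsReparametrization.homotopic {c g : Path x y} (h : IsReparametrization c g) :
    c.Homotopic g := by
  obtain ⟨φ, hφ, -, h0, h1, hcg⟩ := h
  rw [show c = g.reparam φ hφ h0 h1 from Path.ext (funext hcg)]
  exact ⟨(Path.Homotopy.reparam g φ hφ h0 h1).symm⟩

theorem IsShortestInClass.of_homotopic {c₀ c g : Path x y} (hc : IsShortestInClass c₀ c)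
    (hg : c.Homotopic g) (hle : pathLength g ≤ pathLength c) : IsShortestInClass c₀ g :=
  ⟨hc.1.trans hg, fun d hd => hle.trans (hc.2 d hd)⟩

theorem isLocallyMinimizing_of_dist_eq {g : Path x y} (hℓ : 0 < ℓ) (hr0 : 0 < r)
    (h : ∀ s t : I, ℓ * dist s t < r → dist (g s) (g t) = ℓ * dist s t) :
    IsLocallyMinimizing g := by
  have hℓ' : (0 : ℝ) < ℓ := hℓ
  refine ⟨ℓ, hℓ, fun t => ⟨Metric.ball t (r / ℓ / 2), Metric.ball_mem_nhds t (by positivity),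
    fun s hs s' hs' => h s s' ?_⟩⟩
  rw [mul_comm, ← lt_div_iff₀ hℓ']
  rw [Metric.mem_ball] at hs hs'
  linarith [dist_triangle_right s s' t]

variable (hgeo : IsGeodesicSpace X) (hr : LoopsNullInBalls X r)
include hgeo hr

theorem IsShortestInClass.eVariationOn_eq {c₀ c : Path x y} (hc : IsShortestInClass c₀ c)
    (hfin : pathLength c ≠ ⊤) {s t : I} (hst : s ≤ t)
    (hball : c '' Set.Icc s t ⊆ Metric.ball (c s) r) :
    eVariationOn c (Set.Icc s t) = edist (c s) (c t) := by
  refine le_antisymm ?_ (edist_le_eVariationOn c hst)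
  have hshort : (c.subpath s t).Homotopic (hgeo.path (c s) (c t)) := by
    refine hr.homotopic (z := c s) (by rwa [Path.range_subpath_of_le _ _ _ hst])
      (hgeo.range_path_subset ?_)
    rw [dist_self, zero_add, dist_comm]
    exact hball ⟨t, ⟨hst, le_rfl⟩, rfl⟩
  have hs0 : 0 ≤ s := unitInterval.nonneg'
  have ht1 : t ≤ 1 := unitInterval.le_one'
  have hle := hc.2 _ (hc.1.trans (homotopic_of_subpath_homotopic c hshort))
  change pathLength c ≤ pathLength (((c.subpath 0 s).trans _).trans (c.subpath t 1)) at hle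
  rw [pathLength_trans, pathLength_trans, pathLength_subpath c hs0, pathLength_subpath c ht1] at hle
  rw [pathLength_eq, ← eVariationOn_Icc_add_Icc c (hs0.trans hst) ht1,
    ← eVariationOn_Icc_add_Icc c hs0 hst] at hle hfin
  rw [ENNReal.add_ne_top, ENNReal.add_ne_top] at hfin
  rw [ENNReal.add_le_add_iff_right hfin.2, ENNReal.add_le_add_iff_left hfin.1.1] at hle
  exact hle.trans (hgeo.pathLength_path_le _ _)

theorem IsShortestInClass.dist_eq {c₀ g : Path x y} (hg : IsShortestInClass c₀ g)
    (hspeed : HasConstantSpeed g ℓ) {s t : I} (hst : ℓ * dist s t < r) :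
    dist (g s) (g t) = ℓ * dist s t := by
  wlog h : s ≤ t generalizing s t
  · rw [dist_comm, dist_comm s] at *
    exact this hst (le_of_not_ge h)
  have hball : g '' Set.Icc s t ⊆ Metric.ball (g s) r := by
    rintro _ ⟨u, hu, rfl⟩
    rw [Metric.mem_ball, dist_comm]
    calc dist (g s) (g u) ≤ ℓ * dist s u := hspeed.lipschitzWith.dist_le_mul s u
      _ ≤ ℓ * dist s t := by
          gcongr
          exact Real.dist_left_le_of_mem_uIcc (Set.mem_uIcc_of_le hu.1 hu.2)
      _ < r := hst
  have hvar := hg.eVariationOn_eq hgeo hr (hspeed.pathLength_eq ▸ ENNReal.coe_ne_top) h hball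
  rw [hspeed s t h] at hvar
  rw [dist_edist, ← hvar, ENNReal.toReal_mul, ENNReal.coe_toReal, ← dist_edist]

theorem IsShortestInClass.exists_hasConstantSpeed (hr0 : 0 < r) {c₀ c : Path x y}
    (hc : IsShortestInClass c₀ c) (hne : ¬IsConstantPath c) :
    ∃ (ℓ : ℝ≥0) (g : Path x y), 0 < ℓ ∧ IsReparametrization c g ∧ HasConstantSpeed g ℓ ∧
      pathLength g = pathLength c := by
  obtain ⟨c', hc', hfin⟩ := exists_homotopic_pathLength_ne_top hgeo hr0 hr c
  lift pathLength c to ℝ≥0 using ne_top_of_le_ne_top hfin (hc.2 c' (hc.1.trans hc')) with ℓ hℓ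
  have hℓ0 : 0 < ℓ := pos_iff_ne_zero.2 fun h =>
    hne (isConstantPath_of_pathLength_eq_zero c (by rw [← hℓ, h, ENNReal.coe_zero]))
  obtain ⟨g, hrep, hspeed⟩ := exists_isReparametrization_hasConstantSpeed c hℓ.symm hℓ0
  exact ⟨ℓ, g, hℓ0, hrep, hspeed, hspeed.pathLength_eq⟩

theorem IsShortestInClass.constant_or_exists (hr0 : 0 < r) {c₀ c : Path x y}
    (hc : IsShortestInClass c₀ c) : IsConstantPath c ∨ ∃ g : Path x y,
      IsLocallyMinimizing g ∧ IsReparametrization c g ∧ IsShortestInClass c₀ g := by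
  refine or_iff_not_imp_left.2 fun hne => ?_
  obtain ⟨ℓ, g, hℓ, hrep, hspeed, hlen⟩ := hc.exists_hasConstantSpeed hgeo hr hr0 hne
  have hg := hc.of_homotopic hrep.homotopic hlen.le
  exact ⟨g, isLocallyMinimizing_of_dist_eq hℓ hr0 fun s t => hg.dist_eq hgeo hr hspeed, hrep, hg⟩

end ShortestPath

/-! ### Shortest loops -/

section ShortestLoop

theorem freelyHomotopic_subpath_trans {X : Type*} [TopologicalSpace X] {y : X} (g : Path y y)
    {u v : I} {d : Path (g v) (g u)}
    (h : (((g.subpath v 1).cast rfl g.target.symm).trans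
      ((g.subpath 0 u).cast g.source.symm rfl)).Homotopic d) :
    FreelyHomotopic g ((g.subpath u v).trans d) := by
  have hsplit := Path.Homotopic.Quotient.eq.2
    (homotopic_of_subpath_homotopic g (.refl (g.subpath u v)))
  refine freelyHomotopic_of_trans_eq (p := (g.subpath 0 u).cast g.source.symm rfl) ?_
  rw [hsplit, Path.Homotopic.Quotient.mk_trans, ← Path.Homotopic.Quotient.eq.2 h,
    Path.Homotopic.Quotient.mk_trans]
  simp only [← Path.Homotopic.Quotient.trans_assoc]
  rfl

theorem dist_coe_addCircle {ℓ : ℝ} (hℓ : 0 < ℓ) (s t : I) :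
    dist ((ℓ * s : ℝ) : AddCircle ℓ) ((ℓ * t : ℝ) : AddCircle ℓ) =
      ℓ * min (dist s t) (1 - dist s t) := by
  wlog h : t ≤ s generalizing s t
  · rw [dist_comm, dist_comm s, this t s (le_of_not_ge h)]
  have hst : dist s t = s - t := by rw [dist_comm, dist_eq_sub_of_le h]
  rw [dist_eq_norm, ← AddCircle.coe_sub, ← mul_sub, AddCircle.norm_eq' ℓ hℓ,
    inv_mul_cancel_left₀ hℓ.ne', abs_sub_round_eq_min, ← hst]
  have h1 : dist s t ≤ 1 := Real.dist_le_of_mem_Icc_01 s.2 t.2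
  rcases h1.lt_or_eq with h1 | h1
  · rw [Int.fract_eq_self.2 ⟨dist_nonneg, h1⟩]
  · simp [h1]

variable {X : Type*} [MetricSpace X] {r : ℝ} {ℓ : ℝ≥0} {x y : X}

theorem isClosedGeodesic_of_dist_eq {g : Path y y} (hℓ : 0 < ℓ) (hr0 : 0 < r)
    (h : ∀ s t : I, ℓ * min (dist s t) (1 - dist s t) < r →
      dist (g s) (g t) = ℓ * min (dist s t) (1 - dist s t)) : IsClosedGeodesic g := by
  let p (t : I) : AddCircle (ℓ : ℝ) := ((ℓ * t : ℝ) : AddCircle (ℓ : ℝ))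
  have : Fact (0 < (ℓ : ℝ)) := ⟨hℓ⟩
  have hp : Function.Surjective p := fun a => by
    obtain ⟨w, ⟨hw0, hw1⟩, rfl⟩ := (AddCircle.coe_image_Icc_eq (ℓ : ℝ) 0).ge (Set.mem_univ a)
    rw [zero_add] at hw1
    refine ⟨⟨w / ℓ, div_nonneg hw0 ℓ.2, div_le_one_of_le₀ hw1 ℓ.2⟩, ?_⟩
    simp only [p, mul_div_cancel₀ w (NNReal.coe_pos.2 hℓ).ne']
  have hdist (s t : I) (hst : dist (p s) (p t) < r) : dist (g s) (g t) = dist (p s) (p t) := by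
    simp only [p, dist_coe_addCircle (NNReal.coe_pos.2 hℓ)] at hst ⊢
    exact h s t hst
  have hγ (t : I) : g t = g (Function.surjInv hp (p t)) := by
    have h0 : dist (p t) (p (Function.surjInv hp (p t))) = 0 := by
      rw [Function.surjInv_eq hp, dist_self]
    exact dist_eq_zero.1 ((hdist _ _ (h0.trans_lt hr0)).trans h0)
  refine ⟨ℓ, hℓ, fun s => g (Function.surjInv hp s), ⟨r, hr0, fun s t hst => ?_⟩, hγ⟩
  have h' := hdist (Function.surjInv hp s) (Function.surjInv hp t)
  rw [Function.surjInv_eq hp, Function.surjInv_eq hp] at h'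
  exact h' hst

theorem IsShortestInFreeClass.of_homotopic {c₀ : Path x x} {c g : Path y y}
    (hc : IsShortestInFreeClass c₀ c) (hg : c.Homotopic g) (hle : pathLength g ≤ pathLength c) :
    IsShortestInFreeClass c₀ g :=
  ⟨hc.1.trans (freelyHomotopic_of_homotopic hg), fun z d hd => hle.trans (hc.2 z d hd)⟩

theorem IsShortestInFreeClass.isShortestInClass {c₀ : Path x x} {c : Path y y}
    (hc : IsShortestInFreeClass c₀ c) : IsShortestInClass c c :=
  ⟨.refl c, fun d hd => hc.2 y d (hc.1.trans (freelyHomotopic_of_homotopic hd))⟩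

theorem HasConstantSpeed.dist_le_one_sub {g : Path y y} (hg : HasConstantSpeed g ℓ) {u v : I}
    (huv : u ≤ v) : dist (g v) (g u) ≤ ℓ * (1 - dist u v) := by
  calc dist (g v) (g u) ≤ dist (g v) (g 1) + dist (g 0) (g u) := by
        rw [g.target, g.source]
        exact dist_triangle _ _ _
    _ ≤ ℓ * dist v 1 + ℓ * dist 0 u :=
        add_le_add (hg.lipschitzWith.dist_le_mul v 1) (hg.lipschitzWith.dist_le_mul 0 u)
    _ = ℓ * (1 - dist u v) := by
        rw [dist_eq_sub_of_le huv, dist_eq_sub_of_le unitInterval.le_one',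
          dist_eq_sub_of_le unitInterval.nonneg', Set.Icc.coe_one, Set.Icc.coe_zero]
        ring

variable (hgeo : IsGeodesicSpace X) (hr : LoopsNullInBalls X r)
include hgeo hr

theorem HasConstantSpeed.homotopic_path {g : Path y y} (hg : HasConstantSpeed g ℓ) {u v : I}
    (huv : u ≤ v) (h : ℓ * (1 - dist u v) < r) :
    (((g.subpath v 1).cast rfl g.target.symm).trans
      ((g.subpath 0 u).cast g.source.symm rfl)).Homotopic (hgeo.path (g v) (g u)) := by
  refine hr.homotopic (z := g v) (range_trans_subset ?_ ?_) (hgeo.range_path_subset ?_)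
  · rw [Path.cast_coe, Path.range_subpath_of_le _ _ _ unitInterval.le_one']
    rintro _ ⟨t, ht, rfl⟩
    refine (hg.lipschitzWith.dist_le_mul t v).trans_lt (lt_of_le_of_lt ?_ h)
    rw [dist_comm, dist_eq_sub_of_le ht.1, dist_eq_sub_of_le huv]
    gcongr _ * ?_
    linarith [unitInterval.nonneg u, unitInterval.le_one t]
  · rw [Path.cast_coe, Path.range_subpath_of_le _ _ _ unitInterval.nonneg']
    rintro _ ⟨t, ht, rfl⟩
    rw [Metric.mem_ball, dist_comm]
    refine (hg.dist_le_one_sub (ht.2.trans huv)).trans_lt (lt_of_le_of_lt ?_ h)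
    rw [dist_eq_sub_of_le huv, dist_eq_sub_of_le (ht.2.trans huv)]
    gcongr
    exact ht.2
  · rw [dist_self, zero_add]
    exact (hg.dist_le_one_sub huv).trans_lt h

theorem IsShortestInFreeClass.dist_eq_one_sub {c₀ : Path x x} {g : Path y y}
    (hg : IsShortestInFreeClass c₀ g) (hspeed : HasConstantSpeed g ℓ) {u v : I} (huv : u ≤ v)
    (h : ℓ * (1 - dist u v) < r) : dist (g u) (g v) = ℓ * (1 - dist u v) := by
  have hle := hspeed.dist_le_one_sub huv
  refine le_antisymm (dist_comm (g u) (g v) ▸ hle) ?_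
  have hshort := hg.2 _ _ (hg.1.trans (freelyHomotopic_subpath_trans g
    (hspeed.homotopic_path hgeo hr huv h)))
  have hlength : (ℓ : ℝ≥0∞) ≤ ℓ * edist u v + edist (g v) (g u) := by
    calc (ℓ : ℝ≥0∞) = pathLength g := hspeed.pathLength_eq.symm
      _ ≤ pathLength ((g.subpath u v).trans (hgeo.path (g v) (g u))) := hshort
      _ = ℓ * edist u v + pathLength (hgeo.path (g v) (g u)) := by
          rw [pathLength_trans, pathLength_subpath g huv, hspeed u v huv]
      _ ≤ ℓ * edist u v + edist (g v) (g u) := by gcongr; exact hgeo.pathLength_path_le _ _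
  have hreal := ENNReal.toReal_mono (by finiteness) hlength
  rw [ENNReal.toReal_add (by finiteness) (by finiteness), ENNReal.toReal_mul, ENNReal.coe_toReal,
    ← dist_edist, ← dist_edist, dist_comm (g v)] at hreal
  linarith

theorem IsShortestInFreeClass.dist_eq {c₀ : Path x x} {g : Path y y}
    (hg : IsShortestInFreeClass c₀ g) (hspeed : HasConstantSpeed g ℓ) {s t : I}
    (h : ℓ * min (dist s t) (1 - dist s t) < r) :
    dist (g s) (g t) = ℓ * min (dist s t) (1 - dist s t) := by
  wlog hst : s ≤ t generalizing s t
  · rw [dist_comm, dist_comm s] at *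
    exact this h (le_of_not_ge hst)
  rcases le_total (dist s t) (1 - dist s t) with hle | hle
  · rw [min_eq_left hle] at h ⊢
    exact hg.isShortestInClass.dist_eq hgeo hr hspeed h
  · rw [min_eq_right hle] at h ⊢
    exact hg.dist_eq_one_sub hgeo hr hspeed hst h

theorem IsShortestInFreeClass.constant_or_exists (hr0 : 0 < r) {c₀ : Path x x} {c : Path y y}
    (hc : IsShortestInFreeClass c₀ c) : IsConstantPath c ∨ ∃ g : Path y y,
      IsClosedGeodesic g ∧ IsReparametrization c g ∧ IsShortestInFreeClass c₀ g := by
  refine or_iff_not_imp_left.2 fun hne => ?_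
  obtain ⟨ℓ, g, hℓ, hrep, hspeed, hlen⟩ :=
    hc.isShortestInClass.exists_hasConstantSpeed hgeo hr hr0 hne
  have hg := hc.of_homotopic hrep.homotopic hlen.le
  exact ⟨g, isClosedGeodesic_of_dist_eq hℓ hr0 fun s t => hg.dist_eq hgeo hr hspeed, hrep, hg⟩

end ShortestLoop

end DiscreteHomotopy

theorem theorem2 {X : Type*} [MetricSpace X] [CompactSpace X]
    (hgeo : IsGeodesicSpace X) (hslsc : IsSemilocallySimplyConnected X) :
    -- the homotopy critical spectrum has a positive lower bound
    (∃ ε : ℝ, 0 < ε ∧ ε ∈ lowerBounds (homotopyCriticalSpectrum X)) ∧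
    -- consequences for an arbitrary positive lower bound
    ∀ (ε : ℝ) (hε : 0 < ε), ε ∈ lowerBounds (homotopyCriticalSpectrum X) →
      -- (1) the endpoint map is the universal covering map, for every base point
      (∀ p : X, IsUniversalCoveringMap (endpointMap ε p)) ∧
      -- (2) `Λ` preserves lengths of all classes of paths ...
      (∀ (x y : X) (q : Path.Homotopic.Quotient x y),
        pathClassNorm q = ENNReal.ofReal (chainMap hε q).norm) ∧
      -- ... and is an isomorphism from the fundamental group onto `π_ε`, for every base point
      -- (the product `g * h` of `FundamentalGroup X p` is "`h` followed by `g`", so that the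
      -- fundamental group with the concatenation product is its opposite)
      (∀ p : X, ∃ Φ : (FundamentalGroup X p)ᵐᵒᵖ ≃* EpsGroup ε p,
        ∀ g : FundamentalGroup X p, Φ (MulOpposite.op g) = chainMap hε g.toPath) ∧
      -- (3) shortest paths in fixed-endpoint homotopy classes
      (∀ (x y : X) (c : Path x y),
        (∃ c' : Path x y, IsShortestInClass c c' ∧
          (IsConstantPath c' ∨ IsLocallyMinimizing c')) ∧
        ∀ c' : Path x y, IsShortestInClass c c' →
          IsConstantPath c' ∨ ∃ g : Path x y, IsLocallyMinimizing g ∧ IsReparametrization c' g) ∧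
      -- (4) shortest loops in free homotopy classes
      (∀ (x : X) (c : Path x x),
        (∃ (y : X) (c' : Path y y), IsShortestInFreeClass c c' ∧
          (IsConstantPath c' ∨ IsClosedGeodesic c')) ∧
        ∀ (y : X) (c' : Path y y), IsShortestInFreeClass c c' →
          IsConstantPath c' ∨ ∃ g : Path y y, IsClosedGeodesic g ∧ IsReparametrization c' g) := by
  obtain ⟨r, hr0, hr⟩ := exists_loopsNullInBalls hgeo hslsc
  refine ⟨⟨r / 2, half_pos hr0, mem_lowerBounds_homotopyCriticalSpectrum hgeo hr⟩,
    fun ε hε hmem => ⟨isUniversalCoveringMap_endpointMap hgeo hr0 hr hε hmem,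
      fun x y q => pathClassNorm_eq hgeo hr0 hr hε hmem q,
      exists_mulEquiv_chainMap hgeo hr0 hr hε hmem, fun x y c => ⟨?_, fun c' hc' => ?_⟩,
      fun x c => ⟨?_, fun y c' hc' => ?_⟩⟩⟩
  · obtain ⟨c', hc'⟩ := exists_isShortestInClass hgeo hr0 hr c
    rcases hc'.constant_or_exists hgeo hr hr0 with hconst | ⟨g, hmin, -, hg⟩
    · exact ⟨c', hc', Or.inl hconst⟩
    · exact ⟨g, hg, Or.inr hmin⟩
  · exact (hc'.constant_or_exists hgeo hr hr0).imp_right fun ⟨g, hmin, hrep, _⟩ => ⟨g, hmin, hrep⟩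
  · obtain ⟨y, c', hc'⟩ := exists_isShortestInFreeClass hgeo hr0 hr c
    rcases hc'.constant_or_exists hgeo hr hr0 with hconst | ⟨g, hgeod, -, hg⟩
    · exact ⟨y, c', hc', Or.inl hconst⟩
    · exact ⟨y, g, hg, Or.inr hgeod⟩
  · exact (hc'.constant_or_exists hgeo hr hr0).imp_right fun ⟨g, hgeod, hrep, _⟩ =>
      ⟨g, hgeod, hrep⟩
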